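/- Conventions. Let $V$ be a finite set. A definite Horn CNF on $V$ is a finite conjunction of clauses $A\to v$ with $A\subseteq V$, $v\in V\setminus A$; a set $T\subseteq V$ satisfies $A\to v$ if $A\not\subseteq T$ or $v\in T$. A Boolean function $h:2^V\to\{0,1\}$ is definite Horn if it is represented by a definite Horn CNF. An implication $A\to v$ is an implicate of a Boolean function $f$ if every true set of $f$ (every $T$ with $f(T)=1$) satisfies it. A set $I\subseteq V$ is an implicate set of $f$ if $I\setminus\{v\}\to v$ is an implicate of $f$ for all $v\in I$; $\mathcal I(f)$ is the family of implicate sets. The implicate-dual $f^i$ of $f$ is the Boolean function whose true sets are the complements $V\setminus I$ of the sets $I\in\mathcal I(f)$. A Boolean function is hypergraph Horn if for some hypergraph $\mathcal H\subseteq 2^V$ it is represented by the conjunction of all implications $H\setminus\{v\}\to v$ with $v\in H\in\mathcal H$. Definite Horn CNFs are given as input with $V$ listed explicitly, by the incidence matrix of clauses and variables (so the input length is polynomially related to $|V|$ plus the length of the CNF). Corollary. (1) The problem of deciding, for a given definite Horn CNF representing a function $h$, whether $h=h^i$ belongs to co-NP. Consider the following two kinds of certificates for a definite Horn function $h$ on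 $V$: (a) two (possibly equal) implicate sets $I,I'\in\mathcal I(h)$ with $|I\cap I'|=1$; (b) a set $S\subseteq V$ with $S\notin\mathcal I(h)$ and $|S\cap I|\neq 1$ for all $I\in\mathcal I(h)$. (2) Given a definite Horn CNF representing $h$, and a pair $(I,I')$ or a set $S$ (written as characteristic vectors), it can be decided in polynomial time whether this is a certificate of kind (a) or of kind (b), respectively. (3) For every definite Horn function $h$ we have $h\neq h^i$ if and only if $h$ is not hypergraph Horn or there is a certificate of kind (a) or (b). In particular, each such certificate proves $h\neq h^i$, and for hypergraph Horn functions $h$ such a certificate exists whenever $h\neq h^i$. -/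

import Mathlib

/-! ### Boolean functions, definite Horn functions and implicate duality -/

/-- A Boolean function `2^V → {0,1}`; `f T = true` means that `T` is a true set of `f`. -/
abbrev BoolFn (V : Type*) := Finset V → Bool

/-- The set `T` satisfies the implication `A → v`. -/
def SatisfiesImp {V : Type*} (A : Finset V) (v : V) (T : Finset V) : Prop :=
  A ⊆ T → v ∈ T

instance {V : Type*} [DecidableEq V] (A : Finset V) (v : V) (T : Finset V) :
    Decidable (SatisfiesImp A v T) := by
  unfold SatisfiesImp; infer_instance

/-- A definite Horn clause `body → head`: the disjunction of the single positive literal `head`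
and of the negations of the variables in `body`, without a complementary pair of literals. -/
structure DefiniteHornClause (V : Type*) where
  body : Finset V
  head : V
  head_notMem : head ∉ body

/-- A definite Horn CNF: a finite conjunction of definite Horn clauses. -/
abbrev DefiniteHornCNF (V : Type*) := List (DefiniteHornClause V)

/-- The Boolean function represented by a definite Horn CNF. -/
def DefiniteHornCNF.eval {V : Type*} [DecidableEq V] (Ψ : DefiniteHornCNF V) : BoolFn V :=
  fun T => decide (∀ C ∈ Ψ, SatisfiesImp C.body C.head T)

/-- A Boolean function is definite Horn if a definite Horn CNF represents it. -/
def IsDefiniteHorn {V : Type*} [DecidableEq V] (h : BoolFn V) : Prop :=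
  ∃ Ψ : DefiniteHornCNF V, Ψ.eval = h

/-- The Boolean function of the circular CNF of a hypergraph `H`: the conjunction of all
implications `(E - v) → v` with `E ∈ H` and `v ∈ E`. -/
def circularFn {V : Type*} [DecidableEq V] (H : Finset (Finset V)) : BoolFn V :=
  fun T => decide (∀ E ∈ H, ∀ v ∈ E, SatisfiesImp (E.erase v) v T)

/-- A Boolean function is hypergraph Horn if the circular CNF of some hypergraph represents it. -/
def IsHypergraphHorn {V : Type*} [DecidableEq V] (h : BoolFn V) : Prop :=
  ∃ H : Finset (Finset V), circularFn H = h

/-- `A → v` is an implicate of `f`: it is satisfied by every true set of `f`. -/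
def IsImplicate {V : Type*} (f : BoolFn V) (A : Finset V) (v : V) : Prop :=
  ∀ T : Finset V, f T = true → SatisfiesImp A v T

/-- `I` is an implicate set of `f`: `(I - v) → v` is an implicate of `f` for all `v ∈ I`. -/
def IsImplicateSet {V : Type*} [DecidableEq V] (f : BoolFn V) (I : Finset V) : Prop :=
  ∀ v ∈ I, IsImplicate f (I.erase v) v

instance {V : Type*} [Fintype V] [DecidableEq V] (f : BoolFn V) (I : Finset V) :
    Decidable (IsImplicateSet f I) := by
  unfold IsImplicateSet IsImplicate; infer_instance

/-- The implicate-dual of `f`: its true sets are the complements of the implicate sets of `f`. -/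
def iDual {V : Type*} [Fintype V] [DecidableEq V] (f : BoolFn V) : BoolFn V :=
  fun T => decide (IsImplicateSet f Tᶜ)

/-! ### Certificates -/

/-- The two shapes of a certificate: a pair of sets, or a single set. -/
inductive Certificate (V : Type*)
  | pair (I J : Finset V)
  | single (S : Finset V)

/-- A pair certifies if it consists of two (possibly equal) implicate sets that meet in exactly
one element; a single set certifies if it is not an implicate set and the number of elements in
which it meets an implicate set is never one. -/
def Certificate.Certifies {V : Type*} [DecidableEq V] (f : BoolFn V) : Certificate V → Prop
  | .pair I J => IsImplicateSet f I ∧ IsImplicateSet f J ∧ (I ∩ J).card = 1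
  | .single S => ¬ IsImplicateSet f S ∧ ∀ I, IsImplicateSet f I → (S ∩ I).card ≠ 1

/-! ### Polynomial time, NP and co-NP, over Turing machines -/

/-- The binary relation `R` between words over `Γ` and bit strings is decidable in polynomial
time by a Turing machine that reads the two words one after the other, in disjoint alphabets. -/
def PolyTimeRel {Γ : Type} (R : List Γ → List Bool → Prop) : Prop :=
  ∃ f : List Γ × List Bool → Bool,
    (∀ w c, f (w, c) = true ↔ R w c) ∧
    Nonempty (Turing.TM2ComputableInPolyTime
      (Computability.encodingProd (Computability.encodingList Γ)
        (Computability.encodingList Bool)).encode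
      Computability.encodeBool f)

/-- The class NP: the members of `L` are the words that have a certificate of polynomial length
accepted by a polynomial-time verifier. -/
def InNP {Γ : Type} (L : Language Γ) : Prop :=
  ∃ (p : Polynomial ℕ) (R : List Γ → List Bool → Prop), PolyTimeRel R ∧
    ∀ w, w ∈ L ↔ ∃ c : List Bool, c.length ≤ p.eval w.length ∧ R w c

/-- The class co-NP. -/
def InCoNP {Γ : Type} (L : Language Γ) : Prop :=
  InNP Lᶜ

/-! ### Encoding of the input -/

/-- The alphabet in which CNFs are written down. -/
inductive CNFSymbol
  | var
  | absent
  | neg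
  | pos
  | sep
  deriving DecidableEq

instance : Fintype CNFSymbol :=
  ⟨{.var, .absent, .neg, .pos, .sep}, fun x => by cases x <;> decide⟩

/-- How the variable `v` occurs in the clause `C`. -/
def DefiniteHornClause.symbol {V : Type*} [DecidableEq V] (C : DefiniteHornClause V) (v : V) :
    CNFSymbol :=
  if v = C.head then .pos else if v ∈ C.body then .neg else .absent

/-- A CNF over the variables `0, …, n-1` is written as the list of its variables (`n` times the
symbol `var`) followed by the rows of its clause-variable incidence matrix, with a separator after
the list of variables and after each row. The length is `(n + 1) * (|Ψ| + 1)`. -/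
def encodeCNF {n : ℕ} (Ψ : DefiniteHornCNF (Fin n)) : List CNFSymbol :=
  List.replicate n .var ++ .sep :: Ψ.flatMap fun C => List.ofFn C.symbol ++ [.sep]

/-- The characteristic vector of a set. -/
def charVec {n : ℕ} (S : Finset (Fin n)) : List Bool :=
  List.ofFn fun v => decide (v ∈ S)

/-- A certificate is written as one bit for its shape, followed by characteristic vectors. -/
def Certificate.encode {n : ℕ} : Certificate (Fin n) → List Bool
  | .pair I J => true :: (charVec I ++ charVec J)
  | .single S => false :: charVec S

/-- The decision problem `h = h^i` for functions `h` represented by definite Horn CNFs, as a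
formal language. -/
def selfIDualProblem : Language CNFSymbol :=
  {w | ∃ (n : ℕ) (Ψ : DefiniteHornCNF (Fin n)), encodeCNF Ψ = w ∧ Ψ.eval = iDual Ψ.eval}

/-- The bit string `c` encodes a certificate for the function represented by the definite Horn CNF
that the word `w` encodes. -/
def CertificateRel (w : List CNFSymbol) (c : List Bool) : Prop :=
  ∃ (n : ℕ) (Ψ : DefiniteHornCNF (Fin n)) (C : Certificate (Fin n)),
    encodeCNF Ψ = w ∧ C.encode = c ∧ C.Certifies Ψ.eval

/-! ### Structured stack programs and their compilation to Turing machines -/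

/-! Duality. Call two sets orthogonal if they do not meet in exactly one element. The implication
`(I - v) → v` fails at `T` exactly when `I \ T = {v}`, so the family `ℐ` of implicate sets of `h` is
`𝒞^⊥`, where `𝒞` consists of the complements of the true sets (`isImplicateSet_iff`). Now `h = h^i`
says `𝒞 = ℐ`, and the implicate sets of `h^i` form `ℐ^⊥` (`isImplicateSet_iDual`). Being hypergraph
Horn means `𝒞 = ℋ^⊥` for some `ℋ`, equivalently `𝒞 = ℐ^⊥`. Certificates of kind (a) are absent iff
`ℐ ⊆ ℐ^⊥`, those of kind (b) iff `ℐ^⊥ ⊆ ℐ`. Hence `h = h^i` iff `𝒞 = ℐ^⊥` and `ℐ = ℐ^⊥`, which is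
`ne_iDual_iff`.

Algorithms. On `n` variables, `n` rounds of forward chaining give the least true set above a given
set (`iterate_chain`), which decides implicates. Deleting variables not implied by the remaining
ones leads to the largest implicate subset of any set (`core_markData`); a set is an implicate set
iff nothing is lost. For `s ∈ S`, some implicate set `I` has `S ∩ I = {s}` iff the largest implicate
subset of `Sᶜ ∪ {s}` contains `s` (`checkNext_markData`), so kind (b) needs `n` such computations.
For co-NP the witness is a set on which `h` and `h^i` differ.

Machines. The algorithms are written as structured stack programs with a timed big-step semantics
and compiled to Turing machines (`Runs.reaches`, `computableInPolyTime`). Each variable is a stack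
cell of Boolean marks, and `Sim` expresses that a program computes a function of these marks in
polynomial time. It is closed under composition, branching and `n`-fold iteration;
`polyTimeRel_verifierRel` adds the parsing of the input. -/

/-- Structured programs over a family of stacks with alphabets `Γ k` and a control state in `σ`. -/
inductive StackProg {K : Type} (Γ : K → Type) (σ : Type)
  | push (k : K) (f : σ → Γ k)
  | pop (k : K) (f : σ → Option (Γ k) → σ)
  | load (f : σ → σ)
  | seq (p q : StackProg Γ σ)
  | ite (b : σ → Bool) (p q : StackProg Γ σ)
  | loop (b : σ → Bool) (p : StackProg Γ σ)

namespace StackProg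

variable {K : Type} {Γ : K → Type} {σ : Type}

/-- `Runs p v S v' S' t`: started with control state `v` and stacks `S`, the program `p` halts
within `t` steps with control state `v'` and stacks `S'`. -/
inductive Runs [DecidableEq K] : StackProg Γ σ → σ → (∀ k, List (Γ k)) →
    σ → (∀ k, List (Γ k)) → ℕ → Prop
  | push (k f v S) : Runs (.push k f) v S v (Function.update S k (f v :: S k)) 1
  | pop (k f v S) :
      Runs (.pop k f) v S (f v (S k).head?) (Function.update S k (S k).tail) 1
  | load (f v S) : Runs (.load f) v S (f v) S 1
  | seq {p q v₁ S₁ v₂ S₂ v₃ S₃ t₁ t₂} : Runs p v₁ S₁ v₂ S₂ t₁ → Runs q v₂ S₂ v₃ S₃ t₂ →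
      Runs (.seq p q) v₁ S₁ v₃ S₃ (t₁ + t₂)
  | ite_true {b p q v S v' S' t} : b v = true → Runs p v S v' S' t →
      Runs (.ite b p q) v S v' S' (t + 1)
  | ite_false {b p q v S v' S' t} : b v = false → Runs q v S v' S' t →
      Runs (.ite b p q) v S v' S' (t + 1)
  | loop_true {b p v₁ S₁ v₂ S₂ v₃ S₃ t₁ t₂} : b v₁ = true → Runs p v₁ S₁ v₂ S₂ t₁ →
      Runs (.loop b p) v₂ S₂ v₃ S₃ t₂ → Runs (.loop b p) v₁ S₁ v₃ S₃ (t₁ + t₂ + 1)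
  | loop_false {b p v S} : b v = false → Runs (.loop b p) v S v S 1
  | mono {p v S v' S' t t'} : Runs p v S v' S' t → t ≤ t' → Runs p v S v' S' t'

/-- The program positions of a program. -/
def Pos : StackProg Γ σ → Type
  | push _ _ => Unit
  | pop _ _ => Unit
  | load _ => Unit
  | seq p q => Pos p ⊕ Pos q
  | ite _ p q => Option (Pos p ⊕ Pos q)
  | loop _ p => Option (Pos p)

/-- There are finitely many program positions. -/
@[reducible] def posFintype : (p : StackProg Γ σ) → Fintype p.Pos
  | push _ _ => inferInstanceAs (Fintype Unit)
  | pop _ _ => inferInstanceAs (Fintype Unit)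
  | load _ => inferInstanceAs (Fintype Unit)
  | seq p q =>
    letI := posFintype p
    letI := posFintype q
    inferInstanceAs (Fintype (p.Pos ⊕ q.Pos))
  | ite _ p q =>
    letI := posFintype p
    letI := posFintype q
    inferInstanceAs (Fintype (Option (p.Pos ⊕ q.Pos)))
  | loop _ p =>
    letI := posFintype p
    inferInstanceAs (Fintype (Option p.Pos))

/-- The position at which the execution of a program starts. -/
def entry : (p : StackProg Γ σ) → p.Pos
  | push _ _ => ()
  | pop _ _ => ()
  | load _ => ()
  | seq p _ => .inl p.entry
  | ite _ _ _ => none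
  | loop _ _ => none

open Turing in
/-- The machine code of a program whose positions are embedded into the labels by `emb` and which
leaves to the label `exit`. -/
def code {Λ : Type} : (p : StackProg Γ σ) → (p.Pos → Λ) → Λ → p.Pos → TM2.Stmt Γ Λ σ
  | push k f, _, exit, _ => .push k f (.goto fun _ => exit)
  | pop k f, _, exit, _ => .pop k f (.goto fun _ => exit)
  | load f, _, exit, _ => .load f (.goto fun _ => exit)
  | seq p q, emb, _, .inl x => code p (fun y => emb (.inl y)) (emb (.inr q.entry)) x
  | seq _ q, emb, exit, .inr x => code q (fun y => emb (.inr y)) exit x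
  | ite b p q, emb, _, none => .branch b (.goto fun _ => emb (some (.inl p.entry)))
      (.goto fun _ => emb (some (.inr q.entry)))
  | ite _ p _, emb, exit, some (.inl x) => code p (fun y => emb (some (.inl y))) exit x
  | ite _ _ q, emb, exit, some (.inr x) => code q (fun y => emb (some (.inr y))) exit x
  | loop b p, emb, exit, none => .branch b (.goto fun _ => emb (some p.entry))
      (.goto fun _ => exit)
  | loop _ p, emb, _, some x => code p (fun y => emb (some y)) (emb none) x

open Turing in
/-- The machine code of a program realizes its executions. -/
theorem Runs.reaches [DecidableEq K] {p : StackProg Γ σ} {v : σ} {S : ∀ k, List (Γ k)} {v' : σ}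
    {S' : ∀ k, List (Γ k)} {t : ℕ} (h : Runs p v S v' S' t) {Λ : Type} (m : Λ → TM2.Stmt Γ Λ σ)
    (emb : p.Pos → Λ) (exit : Λ) (hm : ∀ x, m (emb x) = p.code emb exit x) :
    ∃ k ≤ t, (flip bind (TM2.step m))^[k] (some ⟨some (emb p.entry), v, S⟩) =
      some ⟨some exit, v', S'⟩ := by
  have trans : ∀ {a b c : Option (TM2.Cfg Γ Λ σ)} {k₁ k₂ : ℕ},
      (flip bind (TM2.step m))^[k₁] a = b → (flip bind (TM2.step m))^[k₂] b = c →
      (flip bind (TM2.step m))^[k₁ + k₂] a = c := by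
    intro a b c k₁ k₂ h₁ h₂
    rw [add_comm, Function.iterate_add_apply, h₁, h₂]
  -- A subprogram runs on the same machine through another embedding and with another exit label (a
  -- loop body exits to the loop test), so these must vary in the induction.
  induction h generalizing Λ with
  | push k f v S =>
    refine ⟨1, le_rfl, ?_⟩
    simp [flip, hm, code]
  | pop k f v S =>
    refine ⟨1, le_rfl, ?_⟩
    simp [flip, hm, code]
  | load f v S =>
    refine ⟨1, le_rfl, ?_⟩
    simp [flip, hm, code]
  | @seq p q _ _ _ _ _ _ _ _ _ _ ih₁ ih₂ =>
    obtain ⟨k₁, hk₁, e₁⟩ := ih₁ m (fun y => emb (.inl y)) (emb (.inr q.entry))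
      (fun x => hm (.inl x)) trans
    obtain ⟨k₂, hk₂, e₂⟩ := ih₂ m (fun y => emb (.inr y)) exit (fun x => hm (.inr x)) trans
    exact ⟨k₁ + k₂, by omega, trans e₁ e₂⟩
  | @ite_true b p q v S _ _ _ hb _ ih =>
    obtain ⟨k, hk, e⟩ := ih m (fun y => emb (some (.inl y))) exit (fun x => hm (some (.inl x))) trans
    refine ⟨1 + k, by omega, trans ?_ e⟩
    have := hm none
    simp [flip, entry, this, code, hb]
  | @ite_false b p q v S _ _ _ hb _ ih =>
    obtain ⟨k, hk, e⟩ := ih m (fun y => emb (some (.inr y))) exit (fun x => hm (some (.inr x))) trans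
    refine ⟨1 + k, by omega, trans ?_ e⟩
    have := hm none
    simp [flip, entry, this, code, hb]
  | @loop_true b p _ _ _ _ _ _ _ _ hb _ _ ih₁ ih₂ =>
    obtain ⟨k₁, hk₁, e₁⟩ := ih₁ m (fun y => emb (some y)) (emb none) (fun x => hm (some x)) trans
    obtain ⟨k₂, hk₂, e₂⟩ := ih₂ m emb exit hm trans
    refine ⟨1 + k₁ + k₂, by omega, trans (trans ?_ e₁) e₂⟩
    have := hm none
    simp [flip, entry, this, code, hb]
  | @loop_false b p v S hb =>
    refine ⟨1, le_rfl, ?_⟩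
    have := hm none
    simp [flip, entry, this, code, hb]
  | mono _ ht ih =>
    obtain ⟨k, hk, e⟩ := ih m emb exit hm trans
    exact ⟨k, hk.trans ht, e⟩

/-- The total length of the stacks grows by at most one in each step. -/
theorem Runs.size_le [DecidableEq K] [Fintype K] {p : StackProg Γ σ} {v : σ}
    {S : ∀ k, List (Γ k)} {v' : σ} {S' : ∀ k, List (Γ k)} {t : ℕ} (h : Runs p v S v' S' t) :
    ∑ k, (S' k).length ≤ ∑ k, (S k).length + t := by
  have upd : ∀ (S : ∀ k, List (Γ k)) (k : K) (l : List (Γ k)),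
      l.length ≤ (S k).length + 1 →
      ∑ j, (Function.update S k l j).length ≤ ∑ j, (S j).length + 1 := by
    intro S k l hl
    rw [← Finset.add_sum_erase _ _ (Finset.mem_univ k),
      ← Finset.add_sum_erase _ (fun j => (S j).length) (Finset.mem_univ k),
      Function.update_self]
    rw [Finset.sum_congr rfl (g := fun j => (S j).length)]
    · omega
    · intro j hj
      rw [Function.update_of_ne (Finset.ne_of_mem_erase hj)]
  induction h with
  | push k f v S => exact upd _ _ _ (by simp)
  | pop k f v S => exact upd _ _ _ (by simp; omega)
  | load => omega
  | loop_false => omega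
  | _ => omega

open Turing in
/-- The Turing machine of a program. -/
def toFinTM2 [DecidableEq K] [Fintype K] [Fintype σ] (p : StackProg Γ σ) (k₀ k₁ : K)
    [Fintype (Γ k₀)] (v₀ : σ) : FinTM2 where
  K := K
  k₀ := k₀
  k₁ := k₁
  Γ := Γ
  Λ := Option p.Pos
  main := some p.entry
  ΛFin := letI := p.posFintype; inferInstanceAs (Fintype (Option p.Pos))
  σ := σ
  initialState := v₀
  m := fun
    | none => .halt
    | some x => p.code some none x

open Turing in
/-- A program that computes `f` in polynomial time, its output being the only nonempty stack at the
end, witnesses that `f` is computable in polynomial time. -/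
theorem computableInPolyTime [DecidableEq K] [Fintype K] [Fintype σ] (p : StackProg Γ σ)
    (k₀ k₁ : K) [Fintype (Γ k₀)] (v₀ : σ) {α β : Type} (ea : α → List (Γ k₀)) (eb : β → List (Γ k₁))
    (f : α → β) (P : Polynomial ℕ)
    (h : ∀ a, Runs p v₀ (Function.update (fun _ => []) k₀ (ea a)) v₀
      (Function.update (fun _ => []) k₁ (eb (f a))) (P.eval (ea a).length)) :
    Nonempty (TM2ComputableInPolyTime ea eb f) := by
  -- The machine model describes its initial and final stacks by a `dite`; this brings updates into
  -- that form.
  have stk : ∀ (k : K) (l : List (Γ k)), Function.update (fun _ => []) k l =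
      fun j => @dite (List (Γ j)) (j = k) _ (fun e => by rw [e]; exact l) fun _ => [] := by
    intro k l
    funext j
    by_cases e : j = k
    · subst e; simp
    · simp [e]
  refine ⟨⟨⟨p.toFinTM2 k₀ k₁ v₀, Equiv.refl _, Equiv.refl _⟩, P + 1, fun a => Classical.choice ?_⟩⟩
  obtain ⟨k, hk, e⟩ := (h a).reaches (p.toFinTM2 k₀ k₁ v₀).m some none (fun _ => rfl)
  -- The additional step executes `halt` at the exit label `none`; it accounts for `P + 1`.
  refine ⟨⟨⟨k + 1, ?_⟩, ?_⟩⟩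
  · rw [Function.iterate_succ_apply']
    have e' : (flip bind (p.toFinTM2 k₀ k₁ v₀).step)^[k]
        (some (initList (p.toFinTM2 k₀ k₁ v₀) (ea a))) =
        some ⟨some none, v₀, Function.update (fun _ => []) k₁ (eb (f a))⟩ := by
      refine Eq.trans ?_ e
      rw [stk]
      rfl
    have e₁ : List.map (Equiv.refl (Γ k₀)).invFun (ea a) = ea a := List.map_id _
    have e₂ : List.map (Equiv.refl (Γ k₁)).invFun (eb (f a)) = eb (f a) := List.map_id _
    erw [e₁, e₂, e', stk]
    rfl
  · simpa using hk

end StackProg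

/-! ### The concrete stacks and control states -/

/-- The stacks of the verifier: the input, the cells of the variables, a stack to move cells to,
the rows of the incidence matrix, a stack to move rows to, and a stack of loop counters, which also
receives the output. -/
inductive WorkStack
  | inp
  | vec
  | bak
  | rows
  | rowb
  | cnt
  deriving DecidableEq

instance : Fintype WorkStack :=
  ⟨{.inp, .vec, .bak, .rows, .rowb, .cnt}, fun x => by cases x <;> decide⟩

/-- The Boolean marks that are kept for each variable: `a` and `b` hold the input sets, `w` and `x`
working sets, `h` the head of the current clause, `c` and `d` the current variables of two loops. -/
structure Cell where
  a : Bool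
  b : Bool
  w : Bool
  x : Bool
  h : Bool
  c : Bool
  d : Bool

instance : Finite Cell :=
  .of_injective (fun y => (y.a, y.b, y.w, y.x, y.h, y.c, y.d)) fun y z e => by
    cases y; cases z; simpa using e

instance : Inhabited Cell := ⟨⟨false, false, false, false, false, false, false⟩⟩

/-- The Boolean registers of the verifier. -/
structure Flags where
  carry : Bool
  ok : Bool
  res : Bool
  one : Bool
  two : Bool
  bad : Bool
  shape : Option Bool

instance : Finite Flags :=
  .of_injective (fun y => (y.carry, y.ok, y.res, y.one, y.two, y.bad, y.shape)) fun y z e => by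
    cases y; cases z; simpa using e

/-- The control state: the registers and the symbols read last. -/
structure Ctl where
  fl : Flags
  cell : Option Cell
  sym : Option CNFSymbol
  inb : Option (CNFSymbol ⊕ Bool)
  bit : Option Bool

instance : Finite Ctl :=
  .of_injective (fun y => (y.fl, y.cell, y.sym, y.inb, y.bit)) fun y z e => by
    cases y; cases z; simpa using e

/-- The alphabets of the stacks. -/
abbrev WorkAlphabet : WorkStack → Type
  | .inp => CNFSymbol ⊕ Bool
  | .vec => Cell
  | .bak => Cell
  | .rows => CNFSymbol
  | .rowb => CNFSymbol
  | .cnt => Bool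

/-- The content of the six stacks. -/
def memory (i : List (CNFSymbol ⊕ Bool)) (v b : List Cell) (r q : List CNFSymbol) (k : List Bool) :
    ∀ s, List (WorkAlphabet s)
  | .inp => i
  | .vec => v
  | .bak => b
  | .rows => r
  | .rowb => q
  | .cnt => k

abbrev Prog := StackProg WorkAlphabet Ctl

/-! ### Single pushes and pops on the six-stack memory. -/

namespace Prog

open StackProg

variable {fl : Flags} {ce : Option Cell} {sy : Option CNFSymbol} {ib : Option (CNFSymbol ⊕ Bool)}
  {bi : Option Bool} {v v' : Ctl} {i : List (CNFSymbol ⊕ Bool)} {a b : List Cell}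
  {r q : List CNFSymbol} {k : List Bool} {S S' : ∀ s, List (WorkAlphabet s)}

theorem _root_.StackProg.Runs.cast {p : Prog} {v v' w : Ctl} {S S' T : ∀ s, List (WorkAlphabet s)}
    {t : ℕ} (h : Runs p v S v' S' t) (hv : v' = w) (hS : S' = T) : Runs p v S w T t :=
  hv ▸ hS ▸ h

theorem runs_push_vec {f : Ctl → Cell} :
    Runs (.push WorkStack.vec f) v (memory i a b r q k) v (memory i (f v :: a) b r q k) 1 := by
  refine (Runs.push (Γ := WorkAlphabet) WorkStack.vec f v (memory i a b r q k)).cast rfl ?_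
  funext s; cases s <;> rfl

theorem runs_push_bak {f : Ctl → Cell} :
    Runs (.push WorkStack.bak f) v (memory i a b r q k) v (memory i a (f v :: b) r q k) 1 := by
  refine (Runs.push (Γ := WorkAlphabet) WorkStack.bak f v (memory i a b r q k)).cast rfl ?_
  funext s; cases s <;> rfl

theorem runs_push_rows {f : Ctl → CNFSymbol} :
    Runs (.push WorkStack.rows f) v (memory i a b r q k) v (memory i a b (f v :: r) q k) 1 := by
  refine (Runs.push (Γ := WorkAlphabet) WorkStack.rows f v (memory i a b r q k)).cast rfl ?_
  funext s; cases s <;> rfl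

theorem runs_push_rowb {f : Ctl → CNFSymbol} :
    Runs (.push WorkStack.rowb f) v (memory i a b r q k) v (memory i a b r (f v :: q) k) 1 := by
  refine (Runs.push (Γ := WorkAlphabet) WorkStack.rowb f v (memory i a b r q k)).cast rfl ?_
  funext s; cases s <;> rfl

theorem runs_push_cnt {f : Ctl → Bool} :
    Runs (.push WorkStack.cnt f) v (memory i a b r q k) v (memory i a b r q (f v :: k)) 1 := by
  refine (Runs.push (Γ := WorkAlphabet) WorkStack.cnt f v (memory i a b r q k)).cast rfl ?_
  funext s; cases s <;> rfl

theorem runs_pop_inp {f : Ctl → Option (CNFSymbol ⊕ Bool) → Ctl} :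
    Runs (.pop WorkStack.inp f) v (memory i a b r q k) (f v i.head?)
      (memory i.tail a b r q k) 1 := by
  refine (Runs.pop (Γ := WorkAlphabet) WorkStack.inp f v (memory i a b r q k)).cast rfl ?_
  funext s; cases s <;> rfl

theorem runs_pop_vec {f : Ctl → Option Cell → Ctl} :
    Runs (.pop WorkStack.vec f) v (memory i a b r q k) (f v a.head?)
      (memory i a.tail b r q k) 1 := by
  refine (Runs.pop (Γ := WorkAlphabet) WorkStack.vec f v (memory i a b r q k)).cast rfl ?_
  funext s; cases s <;> rfl

theorem runs_pop_bak {f : Ctl → Option Cell → Ctl} :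
    Runs (.pop WorkStack.bak f) v (memory i a b r q k) (f v b.head?)
      (memory i a b.tail r q k) 1 := by
  refine (Runs.pop (Γ := WorkAlphabet) WorkStack.bak f v (memory i a b r q k)).cast rfl ?_
  funext s; cases s <;> rfl

theorem runs_pop_rows {f : Ctl → Option CNFSymbol → Ctl} :
    Runs (.pop WorkStack.rows f) v (memory i a b r q k) (f v r.head?)
      (memory i a b r.tail q k) 1 := by
  refine (Runs.pop (Γ := WorkAlphabet) WorkStack.rows f v (memory i a b r q k)).cast rfl ?_
  funext s; cases s <;> rfl

theorem runs_pop_rowb {f : Ctl → Option CNFSymbol → Ctl} :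
    Runs (.pop WorkStack.rowb f) v (memory i a b r q k) (f v q.head?)
      (memory i a b r q.tail k) 1 := by
  refine (Runs.pop (Γ := WorkAlphabet) WorkStack.rowb f v (memory i a b r q k)).cast rfl ?_
  funext s; cases s <;> rfl

theorem runs_pop_cnt {f : Ctl → Option Bool → Ctl} :
    Runs (.pop WorkStack.cnt f) v (memory i a b r q k) (f v k.head?)
      (memory i a b r q k.tail) 1 := by
  refine (Runs.pop (Γ := WorkAlphabet) WorkStack.cnt f v (memory i a b r q k)).cast rfl ?_
  funext s; cases s <;> rfl

/-! ### Elementary programs -/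

/-- An empty stack delivers `none` to the register, and the loops that scan a whole stack stop on
this value. -/
def popVec : Prog := .pop .vec fun v o => { v with cell := o }
def popBak : Prog := .pop .bak fun v o => { v with cell := o }
def popRows : Prog := .pop .rows fun v o => { v with sym := o }
def popRowb : Prog := .pop .rowb fun v o => { v with sym := o }
def popInp : Prog := .pop .inp fun v o => { v with inb := o }
def popCnt : Prog := .pop .cnt fun v o => { v with bit := o }
def setFlags (f : Flags → Flags) : Prog := .load fun v => { v with fl := f v.fl }

/-- Moves the cells from `bak` back to `vec`, applying `u`. -/
def backward (u : Flags → Cell → Cell) : Prog :=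
  .seq popBak <| .loop (fun v => v.cell.isSome) <|
    .seq (.push .vec fun v => u v.fl (v.cell.getD default)) popBak

theorem runs_backward (u : Flags → Cell → Cell) :
    Runs (backward u) ⟨fl, ce, sy, ib, bi⟩ (memory i a b r q k)
      ⟨fl, none, sy, ib, bi⟩ (memory i ((b.map (u fl)).reverse ++ a) [] r q k)
      (3 * b.length + 2) := by
  -- Loops read one symbol ahead: at the loop test the remaining list is split into `head?`, in the
  -- register, and `tail`, on the stack.
  have loop : ∀ b a : List Cell, Runs (.loop (fun v => v.cell.isSome) <|
      .seq (.push WorkStack.vec fun v => u v.fl (v.cell.getD default)) popBak)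
      ⟨fl, b.head?, sy, ib, bi⟩ (memory i a b.tail r q k)
      ⟨fl, none, sy, ib, bi⟩ (memory i ((b.map (u fl)).reverse ++ a) [] r q k)
      (3 * b.length + 1) := by
    intro b
    induction b with
    | nil => intro a; exact .loop_false rfl
    | cons y b ih =>
      intro a
      have h := ih (u fl y :: a)
      have h' := Runs.loop_true (b := fun v : Ctl => v.cell.isSome) rfl
        (.seq (runs_push_vec (v := ⟨fl, some y, sy, ib, bi⟩)
          (f := fun v => u v.fl (v.cell.getD default))) runs_pop_bak) h
      have e : ((y :: b).map (u fl)).reverse ++ a = (b.map (u fl)).reverse ++ u fl y :: a := by simp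
      rw [e]
      exact h'.mono (by simp; omega)
  exact (Runs.seq runs_pop_bak (loop b a)).mono (by omega)

/-- Moves the cells from `vec` to `bak`, replacing them by means of `u` and changing the registers
by means of `g`. -/
def forward (g : Flags → Cell → Flags) (u : Flags → Cell → Cell) : Prog :=
  .seq popVec <| .loop (fun v => v.cell.isSome) <|
    .seq (.push .bak fun v => u v.fl (v.cell.getD default)) <|
    .seq (.load fun v => { v with fl := g v.fl (v.cell.getD default) }) popVec

/-- The list of cells that `forward g u` produces. -/
def transduce (g : Flags → Cell → Flags) (u : Flags → Cell → Cell) : Flags → List Cell → List Cell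
  | _, [] => []
  | fl, y :: l => u fl y :: transduce g u (g fl y) l

theorem runs_forward (g : Flags → Cell → Flags) (u : Flags → Cell → Cell) :
    Runs (forward g u) ⟨fl, ce, sy, ib, bi⟩ (memory i a b r q k)
      ⟨a.foldl g fl, none, sy, ib, bi⟩
      (memory i [] ((transduce g u fl a).reverse ++ b) r q k) (4 * a.length + 2) := by
  have loop : ∀ (a b : List Cell) (fl : Flags), Runs (.loop (fun v => v.cell.isSome) <|
      .seq (.push WorkStack.bak fun v => u v.fl (v.cell.getD default)) <|
      .seq (.load fun v => { v with fl := g v.fl (v.cell.getD default) }) popVec)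
      ⟨fl, a.head?, sy, ib, bi⟩ (memory i a.tail b r q k)
      ⟨a.foldl g fl, none, sy, ib, bi⟩
      (memory i [] ((transduce g u fl a).reverse ++ b) r q k)
      (4 * a.length + 1) := by
    intro a
    induction a with
    | nil => intro b fl; exact .loop_false rfl
    | cons y a ih =>
      intro b fl
      have h := ih (u fl y :: b) (g fl y)
      have h' := Runs.loop_true (b := fun v : Ctl => v.cell.isSome) rfl
        (.seq (runs_push_bak (v := ⟨fl, some y, sy, ib, bi⟩)
          (f := fun v => u v.fl (v.cell.getD default))) (.seq (.load _ _ _) runs_pop_vec)) h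
      have e : (transduce g u fl (y :: a)).reverse ++ b =
          (transduce g u (g fl y) a).reverse ++ u fl y :: b := by simp [transduce]
      rw [e]
      exact h'.mono (by simp; omega)
  exact (Runs.seq runs_pop_vec (loop a b fl)).mono (by omega)

/-- Moves the rows back from `rowb`. -/
def restoreRows : Prog :=
  .seq popRowb <| .loop (fun v => v.sym.isSome) <|
    .seq (.push .rows fun v => v.sym.getD .sep) popRowb

theorem runs_restoreRows :
    Runs restoreRows ⟨fl, ce, sy, ib, bi⟩ (memory i a b r q k)
      ⟨fl, ce, none, ib, bi⟩ (memory i a b (q.reverse ++ r) [] k)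
      (3 * q.length + 2) := by
  have loop : ∀ q r : List CNFSymbol, Runs (.loop (fun v => v.sym.isSome) <|
      .seq (.push WorkStack.rows fun v => v.sym.getD .sep) popRowb)
      ⟨fl, ce, q.head?, ib, bi⟩ (memory i a b r q.tail k)
      ⟨fl, ce, none, ib, bi⟩ (memory i a b (q.reverse ++ r) [] k)
      (3 * q.length + 1) := by
    intro q
    induction q with
    | nil => intro r; exact .loop_false rfl
    | cons y q ih =>
      intro r
      have h := ih (y :: r)
      have h' := Runs.loop_true (b := fun v : Ctl => v.sym.isSome) rfl
        (.seq (runs_push_rows (v := ⟨fl, ce, some y, ib, bi⟩)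
          (f := fun v => v.sym.getD .sep)) runs_pop_rowb) h
      have e : (y :: q).reverse ++ r = q.reverse ++ y :: r := by simp
      rw [e]
      exact h'.mono (by simp; omega)
  exact (Runs.seq runs_pop_rowb (loop q r)).mono (by omega)

/-! ### Programs as functions on marked variables -/

/-- The data on which the verifier works after the input has been read: the registers and, for each
variable, its marks. -/
abbrev Data (n : ℕ) := Flags × (Fin n → Cell)

/-- The rows of the incidence matrix. -/
def rowsOf {n : ℕ} (Ψ : DefiniteHornCNF (Fin n)) : List CNFSymbol :=
  Ψ.flatMap fun C => List.ofFn C.symbol ++ [.sep]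

/-- The program `p` transforms the data by means of `F`, in time `P`. -/
def Sim {n : ℕ} (Ψ : DefiniteHornCNF (Fin n)) (p : Prog) (F : Data n → Data n)
    (P : Polynomial ℕ) : Prop :=
  -- The counter stack `k` is arbitrary because loops are nested: the counters of the enclosing
  -- loops lie there.
  ∀ d k, Runs p ⟨d.1, none, none, none, none⟩ (memory [] (List.ofFn d.2) [] (rowsOf Ψ) [] k)
    ⟨(F d).1, none, none, none, none⟩ (memory [] (List.ofFn (F d).2) [] (rowsOf Ψ) [] k)
    (P.eval (n + (rowsOf Ψ).length))

variable {n : ℕ} {Ψ : DefiniteHornCNF (Fin n)} {p₁ p₂ : Prog} {F₁ F₂ : Data n → Data n}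
  {P₁ P₂ : Polynomial ℕ}

theorem Sim.seq (h₁ : Sim Ψ p₁ F₁ P₁) (h₂ : Sim Ψ p₂ F₂ P₂) :
    Sim Ψ (.seq p₁ p₂) (fun d => F₂ (F₁ d)) (P₁ + P₂) := fun d k =>
  (Runs.seq (h₁ d k) (h₂ (F₁ d) k)).mono (by simp)

theorem Sim.ite (t : Flags → Bool) (h₁ : Sim Ψ p₁ F₁ P₁) (h₂ : Sim Ψ p₂ F₂ P₂) :
    Sim Ψ (.ite (fun v => t v.fl) p₁ p₂) (fun d => if t d.1 then F₁ d else F₂ d) (P₁ + P₂ + 1) := by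
  intro d k
  by_cases e : t d.1 = true
  · simp only [e, if_true]
    exact (Runs.ite_true (b := fun v : Ctl => t v.fl) e (h₁ d k)).mono (by simp)
  · simp only [e]
    exact (Runs.ite_false (b := fun v : Ctl => t v.fl) (by simpa using e) (h₂ d k)).mono (by simp)

theorem sim_setFlags (f : Flags → Flags) : Sim Ψ (setFlags f) (fun d => (f d.1, d.2)) 1 :=
  fun d k => (Runs.load _ _ _).mono (by simp)

/-- A pass through all variables. -/
def pass (g : Flags → Cell → Flags) (u : Flags → Cell → Cell) : Prog :=
  .seq (forward g u) (backward fun _ y => y)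

theorem runs_pass (g : Flags → Cell → Flags) (u : Flags → Cell → Cell) :
    Runs (pass g u) ⟨fl, ce, sy, ib, bi⟩ (memory i a [] r q k)
      ⟨a.foldl g fl, none, sy, ib, bi⟩ (memory i (transduce g u fl a) [] r q k)
      (7 * a.length + 4) := by
  have len : ∀ (a : List Cell) fl, (transduce g u fl a).length = a.length := by
    intro a
    induction a with
    | nil => intro fl; rfl
    | cons y a ih => intro fl; simp [transduce, ih]
  have h := Runs.seq (runs_forward (fl := fl) (ce := ce) (sy := sy) (ib := ib) (bi := bi) (i := i)
    (a := a) (b := []) (r := r) (q := q) (k := k) g u) (runs_backward fun _ y => y)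
  simp only [List.append_nil, List.map_id', List.reverse_reverse, List.length_reverse, len] at h
  exact h.mono (by omega)

/-- Changes all marks by the same rule. -/
def mapCells (u : Flags → Cell → Cell) : Prog := pass (fun fl _ => fl) u

theorem sim_mapCells (u : Flags → Cell → Cell) :
    Sim Ψ (mapCells u) (fun d => (d.1, fun j => u d.1 (d.2 j))) (7 * .X + 4) := by
  intro d k
  have e : ∀ a : List Cell, transduce (fun fl _ => fl) u d.1 a = a.map (u d.1) := by
    intro a
    induction a with
    | nil => rfl
    | cons y a ih => simp [transduce, ih]
  have h := runs_pass (fl := d.1) (ce := none) (sy := none) (ib := none) (bi := none) (i := [])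
    (a := List.ofFn d.2) (r := rowsOf Ψ) (q := []) (k := k) (fun fl _ => fl) u
  rw [e, List.map_ofFn] at h
  have e' : ∀ (a : List Cell) (fl : Flags), a.foldl (fun fl _ => fl) fl = fl := by
    intro a fl; induction a <;> simp_all
  rw [e'] at h
  exact h.mono (by simp)

/-- Changes the registers reading all marks. -/
def foldCells (g : Flags → Cell → Flags) : Prog := pass g fun _ y => y

theorem sim_foldCells (g : Flags → Cell → Flags) :
    Sim Ψ (foldCells g) (fun d => ((List.ofFn d.2).foldl g d.1, d.2)) (7 * .X + 4) := by
  intro d k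
  have e : ∀ (a : List Cell) fl, transduce g (fun _ y => y) fl a = a := by
    intro a
    induction a with
    | nil => intro fl; rfl
    | cons y a ih => intro fl; simp [transduce, ih]
  have h := runs_pass (fl := d.1) (ce := none) (sy := none) (ib := none) (bi := none) (i := [])
    (a := List.ofFn d.2) (r := rowsOf Ψ) (q := []) (k := k) g (fun _ y => y)
  rw [e] at h
  exact h.mono (by simp)

/-- Shifts the mark `get` by one variable, the first variable obtaining the mark `carry`. -/
def shiftMark (get : Cell → Bool) (set : Bool → Cell → Cell) : Prog :=
  -- A cell is rewritten before the registers are updated, so `carry` still holds the mark of the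
  -- preceding variable.
  pass (fun fl y => { fl with carry := get y }) fun fl y => set fl.carry y

/-- The mark of the preceding variable. -/
def prevMark (get : Cell → Bool) (d : Data n) (j : Fin n) : Bool :=
  if j.val = 0 then d.1.carry else get (d.2 ⟨j.val - 1, by omega⟩)

/-- After the pass `carry` holds the old mark of the last variable. Clearing it makes this mark
disappear instead of entering at the first variable in the next shift. -/
theorem sim_shiftMark (get : Cell → Bool) (set : Bool → Cell → Cell) :
    Sim Ψ (.seq (shiftMark get set) (setFlags fun fl => { fl with carry := false }))
      (fun d => ({ d.1 with carry := false }, fun j => set (prevMark get d j) (d.2 j)))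
      (7 * .X + 5) := by
  intro d k
  have e : ∀ (n : ℕ) (d : Data n), transduce (fun fl y => { fl with carry := get y })
      (fun fl y => set fl.carry y) d.1 (List.ofFn d.2) =
      List.ofFn fun j => set (prevMark get d j) (d.2 j) := by
    intro n
    induction n with
    | zero => intro d; simp [transduce]
    | succ n ih =>
      intro d
      rw [List.ofFn_succ, transduce, List.ofFn_succ]
      have := ih ({ d.1 with carry := get (d.2 0) }, fun j => d.2 j.succ)
      simp only at this
      rw [this]
      congr 1
      congr 1
      funext j
      congr 1
      simp only [prevMark, Fin.val_succ, Nat.add_one_ne_zero, if_false]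
      split_ifs with hj
      · exact congrArg (fun z => get (d.2 z)) (Fin.ext (by simp [hj]))
      · exact congrArg (fun z => get (d.2 z)) (Fin.ext (by simp; omega))
  have fold : ∀ (a : List Cell) (fl : Flags),
      { a.foldl (fun fl y => ({ fl with carry := get y } : Flags)) fl with carry := false } =
      ({ fl with carry := false } : Flags) := by
    intro a
    induction a with
    | nil => intro fl; rfl
    | cons y a ih => intro fl; simp [ih]
  have h := runs_pass (fl := d.1) (ce := none) (sy := none) (ib := none) (bi := none) (i := [])
    (a := List.ofFn d.2) (r := rowsOf Ψ) (q := []) (k := k)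
    (fun fl y => { fl with carry := get y }) (fun fl y => set fl.carry y)
  rw [e] at h
  have h' := Runs.seq h (Runs.load (fun v => { v with fl := { v.fl with carry := false } }) _ _)
  simp only [fold] at h'
  exact h'.mono (by simp; omega)

/-- Executes `p` as many times as there are variables. -/
def repeatAll (p : Prog) : Prog :=
  -- The counter is unary: `false` marks its bottom and one `true` is pushed per variable, so the
  -- counters of nested loops can share one stack.
  .seq (.push .cnt fun _ => false) <|
  .seq (.seq popVec <| .loop (fun v => v.cell.isSome) <|
    .seq (.push .bak fun v => v.cell.getD default) <|
    .seq (.push .cnt fun _ => true) popVec) <|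
  .seq (backward fun _ y => y) <|
  .seq popCnt <|
  .seq (.loop (fun v => v.bit == some true) <|
    .seq (.load fun v => { v with bit := none }) <| .seq p popCnt)
  (.load fun v => { v with bit := none })

theorem Sim.repeatAll (h : Sim Ψ p₁ F₁ P₁) :
    Sim Ψ (repeatAll p₁) (F₁^[n]) (.X * (P₁ + 10) + 10) := by
  have fill : ∀ (fl : Flags) (sy : Option CNFSymbol) (ib : Option (CNFSymbol ⊕ Bool))
      (bi : Option Bool) (i : List (CNFSymbol ⊕ Bool)) (r q : List CNFSymbol) (a b : List Cell)
      (k : List Bool), Runs (.loop (fun v => v.cell.isSome) <|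
      .seq (.push WorkStack.bak fun v => v.cell.getD default) <|
      .seq (.push .cnt fun _ => true) popVec)
      ⟨fl, a.head?, sy, ib, bi⟩ (memory i a.tail b r q k)
      ⟨fl, none, sy, ib, bi⟩
      (memory i [] (a.reverse ++ b) r q (List.replicate a.length true ++ k))
      (4 * a.length + 1) := by
    intro fl sy ib bi i r q a
    induction a with
    | nil => intro b k; exact .loop_false rfl
    | cons y a ih =>
      intro b k
      have h := ih (y :: b) (true :: k)
      have h' := Runs.loop_true (b := fun v : Ctl => v.cell.isSome) rfl
        (.seq (runs_push_bak (v := ⟨fl, some y, sy, ib, bi⟩)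
          (f := fun v => v.cell.getD default))
          (.seq (runs_push_cnt (f := fun _ => true)) runs_pop_vec)) h
      have e : (y :: a).reverse ++ b = a.reverse ++ y :: b := by simp
      have e' : List.replicate (y :: a).length true ++ k =
          List.replicate a.length true ++ true :: k := by
        rw [List.length_cons, List.replicate_succ']; simp
      rw [e, e']
      exact h'.mono (by simp; omega)
  have main : ∀ (m : ℕ) (d : Data n) (k : List Bool), Runs (.loop (fun v => v.bit == some true) <|
      .seq (.load fun v => { v with bit := none }) <| .seq p₁ popCnt)
      ⟨d.1, none, none, none, (List.replicate m true ++ false :: k).head?⟩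
      (memory [] (List.ofFn d.2) [] (rowsOf Ψ) [] (List.replicate m true ++ false :: k).tail)
      ⟨(F₁^[m] d).1, none, none, none, some false⟩
      (memory [] (List.ofFn (F₁^[m] d).2) [] (rowsOf Ψ) [] k)
      (m * (P₁.eval (n + (rowsOf Ψ).length) + 3) + 1) := by
    intro m
    induction m with
    | zero => intro d k; exact (Runs.loop_false rfl).mono (by simp)
    | succ m ih =>
      intro d k
      have h' := ih (F₁ d) k
      exact (Runs.loop_true rfl (.seq (.load _ _ _) (.seq (h d _) runs_pop_cnt)) h').mono
        (by ring_nf; omega)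
  intro d k
  have s₁ := Runs.seq (runs_pop_vec (v := ⟨d.1, none, none, none, none⟩)
    (f := fun v o => { v with cell := o }) (k := false :: k))
    (fill d.1 none none none [] (rowsOf Ψ) [] (List.ofFn d.2) [] (false :: k))
  have s₂ := runs_backward (fl := d.1) (ce := none) (sy := none) (ib := none) (bi := none)
    (i := []) (a := []) (b := (List.ofFn d.2).reverse) (r := rowsOf Ψ) (q := [])
    (k := List.replicate n true ++ false :: k) (fun _ y => y)
  simp only [List.append_nil, List.length_ofFn, List.map_id', List.length_reverse,
    List.reverse_reverse] at s₁ s₂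
  have s₃ := Runs.seq (runs_push_cnt (f := fun _ => false)) <| .seq s₁ <| .seq s₂ <|
    .seq (runs_pop_cnt (f := fun v o => { v with bit := o })) <|
    .seq (main n d k) (.load (fun v => { v with bit := none }) _ _)
  refine s₃.mono ?_
  simp only [Polynomial.eval_add, Polynomial.eval_mul, Polynomial.eval_X, Polynomial.eval_ofNat]
  have : n * (P₁.eval (n + (rowsOf Ψ).length) + 10) ≤
      (n + (rowsOf Ψ).length) * (P₁.eval (n + (rowsOf Ψ).length) + 10) :=
    Nat.mul_le_mul_right _ (by omega)
  -- Of the 10 steps per variable, 7 pay for filling the counter and moving the cells back, 3 for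
  -- the overhead of an iteration.
  have e : n * (P₁.eval (n + (rowsOf Ψ).length) + 10) =
    n * (P₁.eval (n + (rowsOf Ψ).length) + 3) + 7 * n := by ring
  omega

end Prog

namespace Prog

open StackProg

/-! ### One round of forward chaining -/

/-- The treatment of a symbol in a round of forward chaining. While a row is read, the register `ok`
records whether the body of the clause is marked by `x`, and `h` marks its head; at the end of the
row the head is marked by `x` if `ok` holds. -/
def chainStep : Prog :=
    .seq (.push .rowb fun v => v.sym.getD .sep) <|
    .seq (.ite (fun v => v.sym == some .sep)
      (.seq (backward fun fl y => { y with x := y.x || (fl.ok && y.h), h := false })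
        (setFlags fun fl => { fl with ok := true }))
      (.seq popVec <|
        .seq (.push .bak fun v => { v.cell.getD default with h := v.sym == some .pos })
        (.load fun v => { v with
          fl := { v.fl with ok := v.fl.ok && (v.sym != some .neg || (v.cell.getD default).x) }
          cell := none })))
    popRows

/-- The loop of `chainRound`. -/
def chainLoop : Prog := .loop (fun v => v.sym.isSome) chainStep

/-- One round of forward chaining, for the set marked by `x`. -/
def chainRound : Prog :=
  .seq (setFlags fun fl => { fl with ok := true }) <|
  .seq popRows <| .seq chainLoop restoreRows

/-- Continuation form: a run of the remaining loop is extended backwards over the symbols of one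
row. Each symbol moves one cell from `vec` to `bak`, which keeps columns and variables aligned, at
the cost of six steps and a loop test. -/
theorem runs_chainLoop_row {i : List (CNFSymbol ⊕ Bool)} {k : List Bool} {v : Ctl}
    {S : ∀ s, List (WorkAlphabet s)} {t : ℕ} {l : List CNFSymbol} {vec : List Cell} :
    ∀ (rs : List CNFSymbol) (cs : List Cell), rs.length = cs.length → CNFSymbol.sep ∉ rs →
    ∀ (fl : Flags) (b : List Cell) (q : List CNFSymbol),
    Runs chainLoop
      ⟨{ fl with ok := fl.ok && (rs.zip cs).all fun z => z.1 != .neg || z.2.x },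
        none, l.head?, none, none⟩
      (memory i vec ((rs.zip cs).map (fun z => { z.2 with h := z.1 == .pos }) |>.reverse.append b)
        l.tail (rs.reverse ++ q) k) v S t →
    Runs chainLoop ⟨fl, none, (rs ++ l).head?, none, none⟩
      (memory i (cs ++ vec) b (rs ++ l).tail q k) v S (7 * rs.length + t) := by
  intro rs
  induction rs with
  | nil =>
    intro cs hcs _ fl b q h
    obtain rfl : cs = [] := List.eq_nil_of_length_eq_zero hcs.symm
    simpa using h
  | cons y rs ih =>
    intro cs hcs hsep fl b q h
    obtain _ | ⟨z, cs⟩ := cs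
    · simp at hcs
    have hy : y ≠ .sep := fun e => hsep (by simp [e])
    have h' := ih cs (by simpa using hcs) (fun e => hsep (List.mem_cons_of_mem _ e))
      { fl with ok := fl.ok && (y != .neg || z.x) } ({ z with h := y == .pos } :: b) (y :: q)
      (by convert h using 1 <;> simp [Bool.and_assoc])
    have step : Runs chainStep ⟨fl, none, some y, none, none⟩
        (memory i (z :: cs ++ vec) b (rs ++ l) q k)
        ⟨{ fl with ok := fl.ok && (y != .neg || z.x) }, none, (rs ++ l).head?, none, none⟩
        (memory i (cs ++ vec) ({ z with h := y == .pos } :: b) (rs ++ l).tail (y :: q) k) 6 :=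
      .seq runs_push_rowb <| .seq (.ite_false (by simpa using hy) <|
        .seq runs_pop_vec <| .seq runs_push_bak <| .load _ _ _) runs_pop_rows
    exact (Runs.loop_true (b := fun v : Ctl => v.sym.isSome) rfl step h').mono (by simp; omega)

/-- The effect of a clause on the marks in a round of forward chaining. -/
def clauseStep {n : ℕ} (c : Fin n → Cell) (C : DefiniteHornClause (Fin n)) : Fin n → Cell :=
  fun i => { c i with
    x := (c i).x || (decide (∀ j ∈ C.body, (c j).x = true) && decide (i = C.head)), h := false }

/-- A row has `neg` exactly on the body and `pos` exactly on the head. Hence at the separator `ok`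
says that the whole body is marked, and `h` marks the head; the cells are updated on their way back
to `vec`. -/
theorem runs_chainLoop_clause {n : ℕ} {i : List (CNFSymbol ⊕ Bool)} {k : List Bool} {v : Ctl}
    {S : ∀ s, List (WorkAlphabet s)} {t : ℕ} {l q : List CNFSymbol} (fl : Flags)
    (hfl : fl.ok = true) (c : Fin n → Cell) (C : DefiniteHornClause (Fin n))
    (h : Runs chainLoop ⟨fl, none, l.head?, none, none⟩
      (memory i (List.ofFn (clauseStep c C)) [] l.tail ((List.ofFn C.symbol ++ [CNFSymbol.sep]).reverse ++ q)
        k) v S t) :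
    Runs chainLoop ⟨fl, none, (List.ofFn C.symbol ++ [CNFSymbol.sep] ++ l).head?, none, none⟩
      (memory i (List.ofFn c) [] (List.ofFn C.symbol ++ [CNFSymbol.sep] ++ l).tail q k) v S
      (10 * (n + 1) + t) := by
  have hsep : CNFSymbol.sep ∉ List.ofFn C.symbol := by
    simp only [List.mem_ofFn, not_exists, DefiniteHornClause.symbol]
    intro j
    split_ifs <;> simp
  have hz : (List.ofFn C.symbol).zip (List.ofFn c) = List.ofFn fun j => (C.symbol j, c j) :=
    List.ext_getElem (by simp) (by simp)
  have hok : ((List.ofFn C.symbol).zip (List.ofFn c)).all (fun z => z.1 != .neg || z.2.x) =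
      decide (∀ j ∈ C.body, (c j).x = true) := by
    rw [hz, Bool.eq_iff_iff]
    simp only [List.all_eq_true, List.mem_ofFn, decide_eq_true_eq, forall_exists_index,
      forall_apply_eq_imp_iff]
    refine forall_congr' fun j => ?_
    -- `symbol` tests for the head first; this hides no body variable, since the head is not in the
    -- body.
    by_cases hj : j = C.head
    · simp [DefiniteHornClause.symbol, hj, C.head_notMem]
    · by_cases hj' : j ∈ C.body <;> simp [DefiniteHornClause.symbol, hj, hj']
  have hh : ∀ j, (C.symbol j == .pos) = decide (j = C.head) := by
    intro j
    rw [Bool.eq_iff_iff]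
    simp only [beq_iff_eq, decide_eq_true_eq, DefiniteHornClause.symbol]
    split_ifs <;> simp_all
  have step : Runs chainStep
      ⟨{ fl with ok := fl.ok && decide (∀ j ∈ C.body, (c j).x = true) }, none, some .sep, none, none⟩
      (memory i [] (List.ofFn fun j => { c j with h := decide (j = C.head) }).reverse l
        ((List.ofFn C.symbol).reverse ++ q) k)
      ⟨fl, none, l.head?, none, none⟩
      (memory i (List.ofFn (clauseStep c C)) [] l.tail
        ((List.ofFn C.symbol ++ [CNFSymbol.sep]).reverse ++ q) k)
      (3 * n + 6) := by
    have hb := runs_backward (i := i) (a := []) (r := l) (k := k) (ib := none) (bi := none)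
      (fl := { fl with ok := fl.ok && decide (∀ j ∈ C.body, (c j).x = true) }) (ce := none)
      (sy := some .sep) (q := .sep :: ((List.ofFn C.symbol).reverse ++ q))
      (b := (List.ofFn fun j => { c j with h := decide (j = C.head) }).reverse)
      (fun fl y => { y with x := y.x || (fl.ok && y.h), h := false })
    refine ((Runs.seq runs_push_rowb <| .seq (.ite_true (by simp) <|
      .seq hb (.load _ _ _)) runs_pop_rows : Runs chainStep _ _ _ _ _).mono ?_).cast ?_ ?_
    · simp; omega
    · simp [← hfl]
    · simp only [List.map_reverse, List.reverse_reverse, List.map_ofFn, List.append_nil]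
      congr 1
      · congr 1
        funext j
        simp [clauseStep, hfl]
      · simp
  have h' := runs_chainLoop_row (i := i) (vec := []) (l := .sep :: l) (k := k) _ (List.ofFn c)
    (by simp) hsep fl [] q (by
      rw [hok, hz, List.map_ofFn]
      simp only [Function.comp_def, hh, List.append_eq, List.append_nil]
      exact Runs.loop_true (b := fun v : Ctl => v.sym.isSome) rfl step h)
  simp only [List.append_nil] at h'
  rw [List.append_assoc]
  exact h'.mono (by simp; omega)

/-- Clauses act in sequence, so a head marked by one clause already counts for the bodies of later
clauses in the same round. -/
theorem sim_chainRound {n : ℕ} (Ψ : DefiniteHornCNF (Fin n)) :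
    Sim Ψ chainRound (fun d => ({ d.1 with ok := true }, Ψ.foldl clauseStep d.2))
      (13 * .X + 10) := by
  have main : ∀ (Φ : DefiniteHornCNF (Fin n)) (fl : Flags) (c : Fin n → Cell) (q : List CNFSymbol)
      (k : List Bool), fl.ok = true → Runs chainLoop ⟨fl, none, (rowsOf Φ).head?, none, none⟩
      (memory [] (List.ofFn c) [] (rowsOf Φ).tail q k) ⟨fl, none, none, none, none⟩
      (memory [] (List.ofFn (Φ.foldl clauseStep c)) [] [] ((rowsOf Φ).reverse ++ q) k)
      (10 * (rowsOf Φ).length + 1) := by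
    intro Φ
    induction Φ with
    | nil => intro fl c q k _; exact .loop_false rfl
    | cons C Φ ih =>
      intro fl c q k hfl
      have e : rowsOf (C :: Φ) = List.ofFn C.symbol ++ [CNFSymbol.sep] ++ rowsOf Φ := by
        simp [rowsOf]
      rw [e, List.foldl_cons]
      refine ((runs_chainLoop_clause fl hfl c C
        (ih fl (clauseStep c C) _ k hfl)).mono ?_).cast rfl ?_
      · simp; omega
      · simp
  intro d k
  refine ((Runs.seq (.load _ _ _) <| .seq runs_pop_rows <|
    .seq (main Ψ { d.1 with ok := true } d.2 [] k rfl) runs_restoreRows :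
    Runs chainRound _ _ _ _ _).mono ?_).cast rfl ?_
  · simp; omega
  · simp

end Prog

namespace Prog

open StackProg

/-! ### Well-formed words -/

/-- Whether a word is a concatenation of rows of a clause-variable incidence matrix with `n`
columns, except that of the first row the last `a` symbols are left, which contain the symbol `pos`
if and only if `p` is false. -/
def rowsValid (n : ℕ) : ℕ → Bool → List CNFSymbol → Bool
  | a, p, [] => a == n && !p
  | a, p, .sep :: l => a == 0 && p && rowsValid n n false l
  | _, _, .var :: _ => false
  | 0, _, _ :: _ => false
  | a + 1, p, .pos :: l => !p && rowsValid n a true l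
  | a + 1, p, .neg :: l => rowsValid n a p l
  | a + 1, p, .absent :: l => rowsValid n a p l

theorem rowsValid_row (n : ℕ) (l : List CNFSymbol) : ∀ (rs : List CNFSymbol) (p : Bool),
    .sep ∉ rs → .var ∉ rs → rs.count .pos + p.toNat = 1 →
    rowsValid n rs.length p (rs ++ .sep :: l) = rowsValid n n false l := by
  intro rs
  induction rs with
  | nil =>
    intro p _ _ h
    cases p <;> simp_all [rowsValid]
  | cons y rs ih =>
    intro p hs hv h
    simp only [List.mem_cons, not_or] at hs hv
    cases y <;> simp [rowsValid] at * <;> cases p <;> simp_all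

/-- Recovers the first row from an accepting run. Only a state at the beginning of a row may accept
the empty word, whence the first alternative. -/
theorem exists_row_of_rowsValid (n : ℕ) : ∀ (l : List CNFSymbol) (a : ℕ) (p : Bool), a ≤ n →
    rowsValid n a p l = true → (l = [] ∧ a = n ∧ p = false) ∨ ∃ rs l', l = rs ++ .sep :: l' ∧
      rs.length = a ∧ .sep ∉ rs ∧ .var ∉ rs ∧ rs.count .pos + p.toNat = 1 ∧
      rowsValid n n false l' = true := by
  intro l
  induction l with
  | nil =>
    intro a p _ h
    left
    simpa [rowsValid] using h
  | cons y l ih =>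
    intro a p ha h
    right
    by_cases hy : y = .sep
    · subst hy
      simp only [rowsValid, Bool.and_eq_true, beq_iff_eq] at h
      exact ⟨[], l, rfl, h.1.1.symm, by simp, by simp, by simp [h.1.2], h.2⟩
    by_cases hy' : y = .var
    · subst hy'
      simp [rowsValid] at h
    obtain _ | a := a
    · cases y <;> simp [rowsValid] at h hy hy'
    have key : ∃ p', rowsValid n a p' l = true ∧  [y].count .pos + p.toNat = p'.toNat := by
      cases y <;> simp [rowsValid] at h hy hy'
      · exact ⟨p, h, by simp⟩
      · exact ⟨p, h, by simp⟩
      · exact ⟨true, h.2, by simp [h.1]⟩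
    obtain ⟨p', h', hc⟩ := key
    rcases ih a p' (by omega) h' with ⟨rfl, rfl, rfl⟩ | ⟨rs, l', rfl, rfl, h₁, h₂, h₃, h₄⟩
    -- Inside a row fewer than `n` symbols are left, so the word cannot end here.
    · omega
    · refine ⟨y :: rs, l', rfl, rfl, ?_, ?_, ?_, h₄⟩
      · simp [h₁, Ne.symm hy]
      · simp [h₂, Ne.symm hy']
      · rw [List.count_cons]
        simp only [List.count_cons, List.count_nil] at hc
        omega

theorem count_ofFn {α : Type} [DecidableEq α] (x : α) : ∀ {n : ℕ} (f : Fin n → α),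
    (List.ofFn f).count x = (Finset.univ.filter fun j => f j = x).card := by
  intro n
  induction n with
  | zero => intro f; simp
  | succ n ih =>
    intro f
    rw [List.ofFn_succ, List.count_cons, ih, Finset.card_filter, Finset.card_filter,
      Fin.sum_univ_succ, add_comm]
    simp

theorem symbol_eq_pos {n : ℕ} (C : DefiniteHornClause (Fin n)) (j : Fin n) :
    C.symbol j = .pos ↔ j = C.head := by
  unfold DefiniteHornClause.symbol
  split_ifs <;> simp_all

theorem symbol_ne {n : ℕ} (C : DefiniteHornClause (Fin n)) (j : Fin n) :
    C.symbol j ≠ .sep ∧ C.symbol j ≠ .var := by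
  unfold DefiniteHornClause.symbol
  split_ifs <;> simp_all

theorem rowsValid_rowsOf {n : ℕ} (Ψ : DefiniteHornCNF (Fin n)) :
    rowsValid n n false (rowsOf Ψ) = true := by
  induction Ψ with
  | nil => simp [rowsOf, rowsValid]
  | cons C Ψ ih =>
    have h := rowsValid_row n (rowsOf Ψ) (List.ofFn C.symbol) false
      (by simpa [List.mem_ofFn] using fun j => (symbol_ne C j).1)
      (by simpa [List.mem_ofFn] using fun j => (symbol_ne C j).2)
      (by simp [count_ofFn, symbol_eq_pos, Finset.filter_eq'])
    rw [List.length_ofFn, ih] at h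
    simpa [rowsOf] using h

theorem exists_clause_of_row {n : ℕ} (rs : List CNFSymbol) (hn : rs.length = n)
    (hs : .sep ∉ rs) (hv : .var ∉ rs) (hp : rs.count .pos = 1) :
    ∃ C : DefiniteHornClause (Fin n), List.ofFn C.symbol = rs := by
  subst hn
  rw [← List.ofFn_get rs, count_ofFn, Finset.card_eq_one] at hp
  obtain ⟨j₀, h⟩ := hp
  have hj : ∀ j, rs.get j = .pos ↔ j = j₀ := by
    intro j
    have : j ∈ Finset.univ.filter (fun j => rs.get j = .pos) ↔ j ∈ ({j₀} : Finset _) := by rw [h]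
    simpa using this
  refine ⟨⟨Finset.univ.filter fun j => rs.get j = .neg, j₀, ?_⟩, ?_⟩
  · simp only [Finset.mem_filter, not_and]
    rw [(hj j₀).2 rfl]
    simp
  · conv_rhs => rw [← List.ofFn_get rs]
    congr 1
    funext j
    have h₁ : rs.get j ≠ .sep := fun e => hs (e ▸ List.get_mem _ _)
    have h₂ : rs.get j ≠ .var := fun e => hv (e ▸ List.get_mem _ _)
    have h₃ := hj j
    simp only [DefiniteHornClause.symbol, Finset.mem_filter, Finset.mem_univ, true_and]
    split_ifs with e₁ e₂
    · exact (h₃.2 e₁).symm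
    · exact e₂.symm
    · generalize rs.get j = y at *
      cases y <;> simp_all

theorem rowsValid_iff {n : ℕ} (l : List CNFSymbol) :
    rowsValid n n false l = true ↔ ∃ Ψ : DefiniteHornCNF (Fin n), rowsOf Ψ = l := by
  refine ⟨fun h => ?_, fun ⟨Ψ, h⟩ => h ▸ rowsValid_rowsOf Ψ⟩
  induction hN : l.length using Nat.strong_induction_on generalizing l with
  | _ N ih =>
    rcases exists_row_of_rowsValid n l n false le_rfl h with
      ⟨rfl, -, -⟩ | ⟨rs, l', rfl, hn, hs, hv, hp, h'⟩
    · exact ⟨[], rfl⟩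
    · obtain ⟨Ψ, rfl⟩ := ih l'.length (by simp at hN; omega) l' h' rfl
      obtain ⟨C, rfl⟩ := exists_clause_of_row rs hn hs hv (by simpa using hp)
      exact ⟨C :: Ψ, by simp [rowsOf]⟩

/-! ### Unique decoding of CNFs and certificates. -/

theorem encodeCNF_eq {n : ℕ} (Ψ : DefiniteHornCNF (Fin n)) :
    encodeCNF Ψ = List.replicate n .var ++ .sep :: rowsOf Ψ := rfl

theorem replicate_append_inj {α : Type} {x : α} : ∀ {m n : ℕ} {l l' : List α}, l.head? ≠ some x →
    l'.head? ≠ some x → List.replicate m x ++ l = List.replicate n x ++ l' → m = n ∧ l = l' := by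
  intro m
  induction m with
  | zero =>
    intro n l l' hl _ e
    obtain _ | n := n
    · simpa using e
    · subst e
      simp [List.replicate_succ] at hl
  | succ m ih =>
    intro n l l' hl hl' e
    obtain _ | n := n
    · simp only [List.replicate_zero, List.nil_append] at e
      subst e
      simp [List.replicate_succ] at hl'
    · simp only [List.replicate_succ, List.cons_append, List.cons.injEq, true_and] at e
      exact ⟨by rw [(ih hl hl' e).1], (ih hl hl' e).2⟩

theorem symbol_injective {n : ℕ} {C D : DefiniteHornClause (Fin n)} (h : C.symbol = D.symbol) :
    C = D := by
  have hh : C.head = D.head := by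
    rw [← symbol_eq_pos, ← h, symbol_eq_pos]
  have hb : C.body = D.body := by
    ext j
    have hC := C.head_notMem
    have hD := D.head_notMem
    have hj := congrFun h j
    unfold DefiniteHornClause.symbol at hj
    split_ifs at hj <;> simp_all
  cases C; cases D
  simp_all

theorem rowsOf_injective {n : ℕ} : ∀ {Φ Ψ : DefiniteHornCNF (Fin n)}, rowsOf Φ = rowsOf Ψ →
    Φ = Ψ := by
  intro Φ
  induction Φ with
  | nil =>
    intro Ψ h
    cases Ψ with
    | nil => rfl
    | cons C Ψ => simp [rowsOf] at h
  | cons C Φ ih =>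
    intro Ψ h
    cases Ψ with
    | nil => simp [rowsOf] at h
    | cons D Ψ =>
      simp only [rowsOf, List.flatMap_cons, List.append_assoc] at h
      obtain ⟨h₁, h₂⟩ := List.append_inj h (by simp)
      rw [symbol_injective (List.ofFn_injective h₁)]
      rw [ih (List.cons.inj h₂).2]

/-- The language and the relations quantify over all CNFs with a given code. The leading `var`
symbols determine `n`, and then the rows are blocks of known length. -/
theorem encodeCNF_injective {m n : ℕ} {Φ : DefiniteHornCNF (Fin m)} {Ψ : DefiniteHornCNF (Fin n)}
    (h : encodeCNF Φ = encodeCNF Ψ) : m = n ∧ HEq Φ Ψ := by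
  obtain ⟨rfl, h'⟩ := replicate_append_inj (by simp) (by simp) h
  exact ⟨rfl, heq_of_eq (rowsOf_injective (List.cons.inj h').2)⟩

theorem charVec_injective {n : ℕ} {S T : Finset (Fin n)} (h : charVec S = charVec T) : S = T := by
  have := List.ofFn_injective h
  ext j
  simpa using congrFun this j

theorem certificate_encode_injective {n : ℕ} {C D : Certificate (Fin n)}
    (h : C.encode = D.encode) : C = D := by
  cases C <;> cases D <;> simp only [Certificate.encode, List.cons.injEq, reduceCtorEq, false_and,
    true_and] at h
  · obtain ⟨h₁, h₂⟩ := List.append_inj h (by simp [charVec])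
    rw [charVec_injective h₁, charVec_injective h₂]
  · rw [charVec_injective h]

end Prog

namespace Prog

open StackProg

/-! ### Reading the input -/

variable {fl : Flags} {ce : Option Cell} {sy : Option CNFSymbol} {ib : Option (CNFSymbol ⊕ Bool)}
  {bi : Option Bool} {v v' : Ctl} {i : List (CNFSymbol ⊕ Bool)} {a b : List Cell}
  {r q : List CNFSymbol} {k : List Bool} {S S' : ∀ s, List (WorkAlphabet s)}

/-- The step that moves a symbol of the first word of the input to `rowb`. -/
def splitStep : Prog := .seq (.push .rowb fun v => (v.inb.getD (.inr false)).elim id fun _ => .sep) popInp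

/-- Moves the first word of the input to `rows` and the first symbol of the second word to the
register `shape`. -/
def splitInput : Prog :=
  .seq popInp <|
  .seq (.loop (fun v => v.inb.any Sum.isLeft) splitStep) <|
  .seq (.load fun v => { v with
    fl := { v.fl with shape := v.inb.bind Sum.getRight? }
    inb := none })
  restoreRows

theorem runs_splitInput (w : List CNFSymbol) (c : List Bool) :
    Runs splitInput ⟨fl, none, none, none, none⟩ (memory (w.map Sum.inl ++ c.map Sum.inr) [] [] [] [] [])
      ⟨{ fl with shape := c.head? }, none, none, none, none⟩
      (memory (c.tail.map Sum.inr) [] [] w [] []) (6 * w.length + 10) := by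
  have loop : ∀ (w q : List CNFSymbol), Runs (.loop (fun v => v.inb.any Sum.isLeft) splitStep)
      ⟨fl, none, none, (w.map Sum.inl ++ c.map Sum.inr).head?, none⟩
      (memory (w.map Sum.inl ++ c.map Sum.inr).tail [] [] [] q [])
      ⟨fl, none, none, (c.map Sum.inr).head?, none⟩
      (memory (c.map Sum.inr).tail [] [] [] (w.reverse ++ q) []) (3 * w.length + 1) := by
    intro w
    induction w with
    | nil => intro q; exact .loop_false (by cases c <;> rfl)
    | cons y w ih =>
      intro q
      have step : Runs splitStep ⟨fl, none, none, some (.inl y), none⟩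
          (memory (w.map Sum.inl ++ c.map Sum.inr) [] [] [] q [])
          ⟨fl, none, none, (w.map Sum.inl ++ c.map Sum.inr).head?, none⟩
          (memory (w.map Sum.inl ++ c.map Sum.inr).tail [] [] [] (y :: q) []) 2 :=
        .seq runs_push_rowb runs_pop_inp
      exact ((Runs.loop_true (b := fun v : Ctl => v.inb.any Sum.isLeft) rfl step
        (ih (y :: q))).mono (by simp; omega)).cast rfl (by simp)
  refine ((Runs.seq runs_pop_inp <| .seq (loop w []) <| .seq (.load _ _ _) runs_restoreRows :
    Runs splitInput _ _ _ _ _).mono ?_).cast ?_ ?_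
  · simp; omega
  · cases c <;> rfl
  · simp

/-- Reads the list of variables. -/
def readVars : Prog :=
  .seq popRows <| .loop (fun v => v.sym == some CNFSymbol.var) <| .seq (.push .vec fun _ => default) popRows

/-- The first symbol other than `var` stays in the register `sym`, where `verifier` tests whether it
is the separator. -/
theorem runs_readVars (n : ℕ) (w : List CNFSymbol) (hw : w.head? ≠ some CNFSymbol.var) :
    Runs readVars ⟨fl, ce, sy, ib, bi⟩ (memory i [] b (List.replicate n CNFSymbol.var ++ w) q k)
      ⟨fl, ce, w.head?, ib, bi⟩ (memory i (List.replicate n default) b w.tail q k)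
      (3 * n + 2) := by
  have loop : ∀ (n : ℕ) (a : List Cell), Runs (.loop (fun v => v.sym == some CNFSymbol.var) <|
      .seq (.push .vec fun _ => default) popRows)
      ⟨fl, ce, (List.replicate n CNFSymbol.var ++ w).head?, ib, bi⟩
      (memory i a b (List.replicate n CNFSymbol.var ++ w).tail q k)
      ⟨fl, ce, w.head?, ib, bi⟩ (memory i (List.replicate n default ++ a) b w.tail q k)
      (3 * n + 1) := by
    intro n
    induction n with
    | zero => intro a; exact .loop_false (by simpa using hw)
    | succ n ih =>
      intro a
      have step : Runs (.seq (.push .vec fun _ => default) popRows)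
          ⟨fl, ce, some CNFSymbol.var, ib, bi⟩ (memory i a b (List.replicate n CNFSymbol.var ++ w) q k)
          ⟨fl, ce, (List.replicate n CNFSymbol.var ++ w).head?, ib, bi⟩
          (memory i (default :: a) b (List.replicate n CNFSymbol.var ++ w).tail q k) 2 :=
        .seq runs_push_vec runs_pop_rows
      exact ((Runs.loop_true (b := fun v : Ctl => v.sym == some CNFSymbol.var) rfl step
        (ih (default :: a))).mono (by omega)).cast rfl (by simp [List.replicate_succ'])
  exact ((Runs.seq runs_pop_rows (loop n []) : Runs readVars _ _ _ _ _).mono (by omega)).cast rfl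
    (by simp)

def skip : Prog := .load id

def reject : Prog := setFlags fun fl => { fl with bad := true }

/-- The treatment of a symbol in the validation of the rows. -/
def validateStep : Prog :=
  -- The cells count columns: those on `vec` are still to come in the current row, those on `bak`
  -- have been passed. The register `one` records whether `pos` has occurred in the row.
  .seq (.push .rowb fun v => v.sym.getD .sep) <|
  .seq (.ite (fun v => v.sym == some CNFSymbol.sep)
    (.seq popVec <| .ite (fun v => v.cell.isSome || !v.fl.one) reject <|
      .seq (backward fun _ y => y) (setFlags fun fl => { fl with one := false }))
    (.ite (fun v => v.sym == some CNFSymbol.var || (v.sym == some CNFSymbol.pos && v.fl.one)) reject <|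
      .seq popVec <| .ite (fun v => v.cell.isNone) reject <|
      .seq (.push .bak fun v => v.cell.getD default)
      (.load fun v => { v with
        fl := { v.fl with one := v.fl.one || v.sym == some CNFSymbol.pos }
        cell := none })))
  popRows

def validateLoop : Prog := .loop (fun v => v.sym.isSome && !v.fl.bad) validateStep

/-- Checks that the rows are rows of a clause-variable incidence matrix. -/
def validateRows : Prog :=
  .seq popRows <| .seq validateLoop <| .ite (fun v => v.fl.bad) skip <|
  .seq popBak <| .ite (fun v => v.cell.isSome || v.fl.one) reject restoreRows

/-- The automaton `rowsValid` is simulated with its state `a` as the number of cells on `vec` and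
`p` as the register `one`. After a rejection the exact state does not matter: either `bad` is set,
or a nonempty `bak` or the register `one` betrays an unfinished last row. -/
theorem runs_validateLoop (n : ℕ) (hfl : fl.bad = false) : ∀ (l : List CNFSymbol) (a b : ℕ)
    (q : List CNFSymbol) (p : Bool), a + b = n → ∃ v S, Runs validateLoop
      ⟨{ fl with one := p }, none, l.head?, none, none⟩
      (memory i (List.replicate a default) (List.replicate b default) l.tail q k) v S
      ((3 * n + 20) * l.length + 1) ∧
      (rowsValid n a p l = true → v = ⟨{ fl with one := false }, none, none, none, none⟩ ∧
        S = memory i (List.replicate n default) [] [] (l.reverse ++ q) k) ∧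
      (rowsValid n a p l = false → v.fl.bad = true ∨ v.fl.bad = false ∧
        ∃ i a b r q k, S = memory i a b r q k ∧ (b.head?.isSome || v.fl.one) = true) := by
  intro l
  induction l with
  | nil =>
    intro a b q p hab
    refine ⟨_, _, Runs.loop_false rfl, fun h => ?_, fun h => .inr ⟨hfl, _, _, _, _, _, _, rfl, ?_⟩⟩
    · simp only [rowsValid, Bool.and_eq_true, beq_iff_eq, Bool.not_eq_true'] at h
      obtain ⟨rfl, rfl⟩ := h
      obtain rfl : b = 0 := by omega
      exact ⟨rfl, rfl⟩
    · obtain _ | b := b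
      · simp only [rowsValid] at h
        obtain rfl : a = n := by omega
        simpa using h
      · rfl
  | cons y l ih =>
    intro a b q p hab
    -- A symbol either sets `bad`, which ends the loop, or leads to the automaton state for the rest
    -- of the word; `fail` and `next` settle these two outcomes.
    have fail : ∀ S t, rowsValid n a p (y :: l) = false → t ≤ 3 * n + 18 →
        ∀ v : Ctl, v.fl.bad = true →
        Runs validateStep ⟨{ fl with one := p }, none, some y, none, none⟩
          (memory i (List.replicate a default) (List.replicate b default) l q k) v S t →
        ∃ v S, Runs validateLoop
          ⟨{ fl with one := p }, none, (y :: l).head?, none, none⟩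
          (memory i (List.replicate a default) (List.replicate b default) (y :: l).tail q k) v S
          ((3 * n + 20) * (y :: l).length + 1) ∧
          (rowsValid n a p (y :: l) = true → v = ⟨{ fl with one := false }, none, none, none, none⟩ ∧
            S = memory i (List.replicate n default) [] [] ((y :: l).reverse ++ q) k) ∧
          (rowsValid n a p (y :: l) = false → v.fl.bad = true ∨ v.fl.bad = false ∧
            ∃ i a b r q k, S = memory i a b r q k ∧ (b.head?.isSome || v.fl.one) = true) := by
      intro S t hr ht v hv step
      refine ⟨v, S, (Runs.loop_true (b := fun v : Ctl => v.sym.isSome && !v.fl.bad)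
        (by simp [hfl]) step (.loop_false (by simp [hv]))).mono ?_, ?_, fun _ => .inl hv⟩
      · rw [List.length_cons, Nat.mul_succ]; omega
      · rw [hr]; simp
    have next : ∀ a' b' p' t, a' + b' = n → rowsValid n a p (y :: l) = rowsValid n a' p' l →
        t ≤ 3 * n + 18 →
        Runs validateStep ⟨{ fl with one := p }, none, some y, none, none⟩
          (memory i (List.replicate a default) (List.replicate b default) l q k)
          ⟨{ fl with one := p' }, none, l.head?, none, none⟩
          (memory i (List.replicate a' default) (List.replicate b' default) l.tail (y :: q) k) t →
        ∃ v S, Runs validateLoop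
          ⟨{ fl with one := p }, none, (y :: l).head?, none, none⟩
          (memory i (List.replicate a default) (List.replicate b default) (y :: l).tail q k) v S
          ((3 * n + 20) * (y :: l).length + 1) ∧
          (rowsValid n a p (y :: l) = true → v = ⟨{ fl with one := false }, none, none, none, none⟩ ∧
            S = memory i (List.replicate n default) [] [] ((y :: l).reverse ++ q) k) ∧
          (rowsValid n a p (y :: l) = false → v.fl.bad = true ∨ v.fl.bad = false ∧
            ∃ i a b r q k, S = memory i a b r q k ∧ (b.head?.isSome || v.fl.one) = true) := by
      intro a' b' p' t hab' hr ht step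
      obtain ⟨v, S, h, h₁, h₂⟩ := ih a' b' (y :: q) p' hab'
      refine ⟨v, S, (Runs.loop_true (b := fun v : Ctl => v.sym.isSome && !v.fl.bad)
        (by simp [hfl]) step h).mono ?_, ?_, ?_⟩
      · rw [List.length_cons, Nat.mul_succ]; omega
      · rw [hr]; simpa using h₁
      · rw [hr]; exact h₂
    by_cases hsep : y = .sep
    · subst hsep
      by_cases hap : a = 0 ∧ p = true
      · obtain ⟨rfl, rfl⟩ := hap
        obtain rfl : b = n := by omega
        have hb := runs_backward (fl := { fl with one := true }) (ce := none)
          (sy := some CNFSymbol.sep) (ib := none) (bi := none) (i := i) (a := [])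
          (b := List.replicate b default) (r := l) (q := .sep :: q) (k := k) (fun _ y => y)
        simp only [List.map_id', List.reverse_replicate, List.append_nil,
          List.length_replicate] at hb
        refine next b 0 false (3 * b + 8) rfl (by simp [rowsValid]) (by omega) ?_
        exact ((Runs.seq runs_push_rowb <| .seq (.ite_true rfl <|
          .seq (runs_pop_vec (a := [])) <| .ite_false rfl <| .seq hb (.load _ _ _)) runs_pop_rows :
          Runs validateStep ⟨{ fl with one := true }, none, some .sep, none, none⟩
            (memory i [] (List.replicate b default) l q k) _ _ _).mono (by omega))
      · refine fail _ _ (by simp [rowsValid, hap]) ?_ _ ?_ (.seq runs_push_rowb <| .seq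
          (.ite_true rfl <| .seq runs_pop_vec <| .ite_true ?_ <| .load _ _ _) runs_pop_rows)
        · omega
        · rfl
        · cases a <;> simp_all [List.replicate_succ]
    · by_cases hvp : y = .var ∨ (y = .pos ∧ p = true)
      · refine fail _ _ ?_ ?_ _ ?_ (.seq runs_push_rowb <| .seq
          (.ite_false ?_ <| .ite_true ?_ <| .load _ _ _) runs_pop_rows)
        · rcases hvp with rfl | ⟨rfl, rfl⟩
          · simp [rowsValid]
          · cases a <;> simp [rowsValid]
        · omega
        · rfl
        · simpa using hsep
        · simpa using hvp
      · obtain _ | a := a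
        · refine fail _ _ ?_ ?_ _ ?_ (.seq runs_push_rowb <| .seq
            (.ite_false ?_ <| .ite_false ?_ <| .seq runs_pop_vec <| .ite_true rfl <| .load _ _ _)
            runs_pop_rows)
          · clear ih fail next
            cases y <;> simp_all [rowsValid]
          · omega
          · rfl
          · simpa using hsep
          · simpa using hvp
        · refine next a (b + 1) (p || y == CNFSymbol.pos) 9 (by omega) ?_ (by omega) ?_
          · clear ih fail next
            have e : ∀ p, rowsValid n a p l = rowsValid n a (p || false) l := by simp
            cases y
            case absent | neg => exact e p
            all_goals simp_all [rowsValid]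
          · exact (Runs.seq runs_push_rowb <| .seq (.ite_false (by simpa using hsep) <|
              .ite_false (by simpa using hvp) <| .seq runs_pop_vec <| .ite_false rfl <|
              .seq runs_push_bak <| .load _ _ _) runs_pop_rows :
              Runs validateStep _ _ _ _ _).mono (by omega)

theorem runs_validateRows (n : ℕ) (hfl : fl.bad = false) (h₁ : fl.one = false)
    (l : List CNFSymbol) : ∃ v S, Runs validateRows ⟨fl, none, sy, none, none⟩
      (memory i (List.replicate n default) [] l [] k) v S ((3 * n + 30) * l.length + 10) ∧
      (rowsValid n n false l = true → v = ⟨fl, none, none, none, none⟩ ∧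
        S = memory i (List.replicate n default) [] l [] k) ∧
      (rowsValid n n false l = false → v.fl.bad = true) := by
  obtain ⟨v, S, h, ht, hf⟩ := runs_validateLoop (i := i) (k := k) n hfl l n 0 [] false rfl
  have e : { fl with one := false } = fl := by rw [← h₁]
  rw [e] at h ht
  have hm : (3 * n + 30) * l.length = (3 * n + 20) * l.length + 10 * l.length := by ring
  cases hr : rowsValid n n false l
  · rcases hf hr with hb | ⟨hb, i, a, b, r, q, k, rfl, hab⟩
    · refine ⟨v, S, (Runs.seq runs_pop_rows <| .seq h <| .ite_true hb (.load _ _ _) :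
        Runs validateRows _ _ _ _ _).mono ?_, by simp, fun _ => hb⟩
      omega
    · refine ⟨_, _, (Runs.seq runs_pop_rows <| .seq h <| .ite_false hb <| .seq runs_pop_bak <|
        .ite_true hab (.load _ _ _) : Runs validateRows _ _ _ _ _).mono ?_, by simp, fun _ => rfl⟩
      omega
  · obtain ⟨rfl, rfl⟩ := ht hr
    refine ⟨_, _, (Runs.seq runs_pop_rows <| .seq h <| .ite_false hfl <| .seq runs_pop_bak <|
        .ite_false (by simpa using h₁) runs_restoreRows :
        Runs validateRows _ _ _ _ _).mono ?_, fun _ => ⟨rfl, ?_⟩, by simp⟩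
    · simp; omega
    · simp

/-- Reads a characteristic vector from the input into a mark. -/
def markStep (set : Bool → Cell → Cell) : Prog :=
  .seq popInp <|
  .seq (.load fun v => { v with
    fl := { v.fl with bad := v.fl.bad || v.inb.isNone }
    cell := v.cell.map (set ((v.inb.bind Sum.getRight?).getD false))
    inb := none }) <|
  .seq (.push .bak fun v => v.cell.getD default) popVec

def readMarks (set : Bool → Cell → Cell) : Prog :=
  .seq popVec <| .seq (.loop (fun v => v.cell.isSome) (markStep set)) (backward fun _ y => y)

/-- Missing bits are read as `false`, but then `bad` is set, so the default never influences an
answer. -/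
theorem runs_readMarks {n : ℕ} (set : Bool → Cell → Cell) (u : List Bool) (c : Fin n → Cell) :
    Runs (readMarks set) ⟨fl, none, none, none, none⟩
      (memory (u.map Sum.inr) (List.ofFn c) [] r q k)
      ⟨{ fl with bad := fl.bad || decide (u.length < n) }, none, none, none, none⟩
      (memory ((u.drop n).map Sum.inr)
        (List.ofFn fun j => set (u.getD j false) (c j)) [] r q k) (8 * n + 10) := by
  have loop : ∀ (a b : List Cell) (u : List Bool) (fl : Flags),
      Runs (.loop (fun v => v.cell.isSome) (markStep set)) ⟨fl, a.head?, none, none, none⟩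
      (memory (u.map Sum.inr) a.tail b r q k)
      ⟨{ fl with bad := fl.bad || decide (u.length < a.length) }, none, none, none, none⟩
      (memory ((u.drop a.length).map Sum.inr) []
        ((a.mapIdx fun j y => set (u.getD j false) y).reverse ++ b) r q k)
      (5 * a.length + 1) := by
    intro a
    induction a with
    | nil =>
      intro b u fl
      exact (Runs.loop_false rfl).cast (by simp) (by simp)
    | cons y a ih =>
      intro b u fl
      have step : Runs (markStep set) ⟨fl, some y, none, none, none⟩
          (memory (u.map Sum.inr) a b r q k)
          ⟨{ fl with bad := fl.bad || u.head?.isNone }, a.head?, none, none, none⟩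
          (memory (u.tail.map Sum.inr) a.tail (set (u.headD false) y :: b) r q k) 4 := by
        cases u <;> exact .seq runs_pop_inp <| .seq (.load _ _ _) <| .seq runs_push_bak runs_pop_vec
      refine ((Runs.loop_true (b := fun v : Ctl => v.cell.isSome) rfl step
        (ih _ u.tail _)).mono (by simp; omega)).cast ?_ ?_
      · cases u with
        | nil => simp
        | cons => simp; congr
      · cases u <;> simp
  refine ((Runs.seq runs_pop_vec <| .seq (loop (List.ofFn c) [] u fl) <|
    runs_backward fun _ y => y : Runs (readMarks set) _ _ _ _ _).cast ?_ ?_).mono ?_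
  · simp
  · simp only [List.append_nil, List.map_id', List.reverse_reverse, List.length_ofFn]
    congr 1
    exact List.ext_getElem (by simp) (by simp)
  · simp; omega

end Prog

namespace Prog

open StackProg

variable {fl : Flags} {ce : Option Cell} {sy : Option CNFSymbol} {ib : Option (CNFSymbol ⊕ Bool)}
  {bi : Option Bool} {v v' : Ctl} {i : List (CNFSymbol ⊕ Bool)} {a b : List Cell}
  {r q : List CNFSymbol} {k : List Bool} {S S' : ∀ s, List (WorkAlphabet s)}

/-- The registers after a certificate of the given shape has been read. -/
def initFlags (shape : Option Bool) : Flags := ⟨false, false, false, false, false, false, shape⟩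

/-- The marks of a certificate. -/
def certCell {n : ℕ} (A B : Finset (Fin n)) (j : Fin n) : Cell :=
  { (default : Cell) with a := decide (j ∈ A), b := decide (j ∈ B) }

/-- The data after a certificate has been read. -/
def certData {n : ℕ} : Certificate (Fin n) → Data n
  | .pair A B => (initFlags (some true), certCell A B)
  | .single A => (initFlags (some false), certCell A ∅)

/-- Reads a certificate. -/
def readCert : Prog :=
  .seq (readMarks fun x y => { y with a := x }) <|
  .seq (.ite (fun v => v.fl.shape == some true) (readMarks fun x y => { y with b := x }) skip) <|
  .seq popInp <| .load fun v => { v with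
    fl := { v.fl with bad := v.fl.bad || v.inb.isSome || v.fl.shape.isNone }
    inb := none }

/-- The set with a given characteristic vector. -/
def setOf {n : ℕ} (u : List Bool) : Finset (Fin n) := Finset.univ.filter fun j => u.getD j false

theorem charVec_setOf {n : ℕ} {u : List Bool} (hu : u.length = n) :
    charVec (setOf u : Finset (Fin n)) = u := by
  subst hu
  refine List.ext_getElem (by simp [charVec]) fun j h₁ h₂ => ?_
  simp [charVec, setOf]

theorem mem_setOf_charVec {n : ℕ} (A : Finset (Fin n)) (u : List Bool) (j : Fin n) :
    (charVec A ++ u).getD j false = decide (j ∈ A) := by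
  rw [List.getD_append _ _ _ _ (by simp [charVec])]
  simp [charVec]

/-- A missing shape bit, missing bits and surplus bits all set `bad`. Otherwise the lengths are
right, and the word is the code of the sets that were read. -/
theorem runs_readCert (n : ℕ) (c : List Bool) : ∃ v S, Runs readCert
    ⟨initFlags c.head?, none, none, none, none⟩
    (memory (c.tail.map Sum.inr) (List.replicate n default) [] r q k) v S (16 * n + 25) ∧
    (∀ C : Certificate (Fin n), C.encode = c → v = ⟨(certData C).1, none, none, none, none⟩ ∧
      S = memory [] (List.ofFn (certData C).2) [] r q k) ∧
    ((∀ C : Certificate (Fin n), C.encode ≠ c) → v.fl.bad = true) := by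
  have e : List.replicate n default = List.ofFn fun _ : Fin n => (default : Cell) := by simp
  rw [e]
  have h₁ := runs_readMarks (fl := initFlags c.head?) (r := r) (q := q) (k := k)
    (fun x y => { y with a := x }) c.tail fun _ : Fin n => (default : Cell)
  by_cases hs : c.head? = some true
  · obtain ⟨u, rfl⟩ : ∃ u, c = true :: u := by
      cases c <;> simp_all
    have h₂ := runs_readMarks (fl := { initFlags (some true) with
      bad := false || decide (u.length < n) }) (r := r) (q := q) (k := k)
      (fun x y => { y with b := x }) (u.drop n)
      fun j : Fin n => { (default : Cell) with a := u.getD j false }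
    refine ⟨_, _, (Runs.seq h₁ <| .seq (.ite_true rfl h₂) <| .seq runs_pop_inp <|
      .load _ _ _ : Runs readCert _ _ _ _ _).mono (by omega), ?_, ?_⟩
    · intro C hC
      cases C with
      | single A => simp [Certificate.encode] at hC
      | pair A B =>
        obtain rfl : charVec A ++ charVec B = u := by simpa [Certificate.encode] using hC
        have lA : (charVec A).length = n := by simp [charVec]
        have lB : (charVec B).length = n := by simp [charVec]
        have d₁ : (charVec A ++ charVec B).drop n = charVec B := List.drop_left' lA
        have hA := mem_setOf_charVec A (charVec B)
        have hB := mem_setOf_charVec B []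
        rw [List.append_nil] at hB
        constructor
        · simp [d₁, lA, lB, certData, initFlags]
        · simp only [d₁]
          congr 1
          · simp [lB]
          · congr 1
            funext j
            simp only [hA, hB]
            rfl
    · intro hC
      by_contra hb
      simp only [initFlags, Bool.not_eq_true, Bool.or_eq_false_iff, decide_eq_false_iff_not,
        not_lt, List.length_drop] at hb
      obtain ⟨⟨⟨hb₁, hb₂⟩, hb₃⟩, -⟩ := hb
      have l₁ : u.length = n + n := by
        have : (u.drop n).drop n = [] := by simpa using hb₃
        have := congrArg List.length this
        simp only [List.length_drop, List.length_nil] at this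
        omega
      refine hC (.pair (setOf (u.take n)) (setOf (u.drop n))) ?_
      rw [Certificate.encode, charVec_setOf (by simp; omega), charVec_setOf (by simp; omega),
        List.take_append_drop]
  · refine ⟨_, _, (Runs.seq h₁ <| .seq (.ite_false (by simpa [initFlags] using hs) <|
      .load _ _ _) <| .seq runs_pop_inp <| .load _ _ _ : Runs readCert _ _ _ _ _).mono (by omega),
      ?_, ?_⟩
    · intro C hC
      cases C with
      | pair A B => simp [← hC, Certificate.encode] at hs
      | single A =>
        subst hC
        have lA : (charVec A).length = n := by simp [charVec]
        have d₁ : (charVec A).drop n = [] := by simp [lA]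
        have hA := mem_setOf_charVec A []
        rw [List.append_nil] at hA
        simp only [Certificate.encode, List.tail_cons, d₁]
        constructor
        · simp [lA, certData, initFlags]
        · congr 1
          congr 1
          funext j
          simp only [hA]
          rfl
    · intro hC
      by_contra hb
      simp only [initFlags, Bool.not_eq_true, Bool.or_eq_false_iff, decide_eq_false_iff_not,
        not_lt, id] at hb
      obtain ⟨⟨⟨-, hb₁⟩, hb₂⟩, hb₃⟩ := hb
      obtain ⟨u, rfl⟩ : ∃ u, c = false :: u := by
        rcases c with _ | ⟨_ | _, u⟩
        · simp at hb₃
        · exact ⟨u, rfl⟩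
        · simp at hs
      have l₁ : u.length = n := by
        have : u.drop n = [] := by simpa using hb₂
        have := congrArg List.length this
        simp only [List.length_drop, List.length_nil, List.tail_cons] at this hb₁
        omega
      refine hC (.single (setOf u)) ?_
      rw [Certificate.encode, charVec_setOf l₁]

/-! ### The verifier -/

/-- Reads the input and executes `Q` on the data that represent it. If the first word is not a
CNF, the answer is `mal`. -/
def verifier (mal : Bool) (Q : Prog) : Prog :=
  .seq splitInput <| .seq readVars <|
  .seq (.ite (fun v => v.sym == some CNFSymbol.sep)
    (.seq (.load fun v => { v with sym := none }) validateRows) reject) <|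
  .ite (fun v => v.fl.bad) (setFlags fun fl => { fl with res := mal }) <|
  .seq readCert <| .ite (fun v => v.fl.bad) (setFlags fun fl => { fl with res := false }) Q

theorem exists_eq_replicate_append {α : Type} [DecidableEq α] (x : α) (w : List α) :
    ∃ n l, w = List.replicate n x ++ l ∧ l.head? ≠ some x := by
  induction w with
  | nil => exact ⟨0, [], by simp⟩
  | cons y w ih =>
    by_cases hy : y = x
    · obtain ⟨n, l, rfl, hl⟩ := ih
      exact ⟨n + 1, l, by simp [hy, List.replicate_succ], hl⟩
    · exact ⟨0, y :: w, by simp, by simpa using hy⟩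

theorem eval_mono (P : Polynomial ℕ) {m n : ℕ} (h : m ≤ n) : P.eval m ≤ P.eval n := by
  rw [Polynomial.eval_eq_sum, Polynomial.eval_eq_sum]
  exact Finset.sum_le_sum fun k _ => Nat.mul_le_mul_left _ (Nat.pow_le_pow_left h k)

/-- The relation that the verifier decides. -/
def VerifierRel (mal : Bool) (D : ∀ n, DefiniteHornCNF (Fin n) → Certificate (Fin n) → Prop)
    (w : List CNFSymbol) (c : List Bool) : Prop :=
  (mal = true ∧ ∀ n (Ψ : DefiniteHornCNF (Fin n)), encodeCNF Ψ ≠ w) ∨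
    ∃ (n : ℕ) (Ψ : DefiniteHornCNF (Fin n)) (C : Certificate (Fin n)),
      encodeCNF Ψ = w ∧ C.encode = c ∧ D n Ψ C

/-- Only the register `res` is specified at the end; the stacks may hold anything, since `answer`
empties them. -/
theorem runs_verifier (mal : Bool) (Q : Prog) (P : Polynomial ℕ)
    (D : ∀ n, DefiniteHornCNF (Fin n) → Certificate (Fin n) → Prop)
    (hQ : ∀ n (Ψ : DefiniteHornCNF (Fin n)), ∃ F, Sim Ψ Q F P ∧
      ∀ C, (F (certData C)).1.res = true ↔ D n Ψ C) (w : List CNFSymbol) (c : List Bool) :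
    ∃ v S, Runs (verifier mal Q) ⟨initFlags none, none, none, none, none⟩
      (memory (w.map Sum.inl ++ c.map Sum.inr) [] [] [] [] []) v S
      ((3 * .X * .X + 80 * .X + 100 + P).eval (w.length + c.length)) ∧
      (v.fl.res = true ↔ VerifierRel mal D w c) := by
  -- A bound common to all branches, with `n` variables and `l` symbols in the rows. The quadratic
  -- term comes from the validation of the rows.
  have time : ∀ n l t : ℕ, n + l ≤ w.length → t ≤ (3 * n + 30) * l + 6 * w.length + 30 * n + 70 +
      P.eval (n + l) →
      t ≤ (3 * .X * .X + 80 * .X + 100 + P).eval (w.length + c.length) := by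
    intro n l t hl ht
    simp only [Polynomial.eval_add, Polynomial.eval_mul, Polynomial.eval_X, Polynomial.eval_ofNat]
    have h₁ : P.eval (n + l) ≤ P.eval (w.length + c.length) := eval_mono P (by omega)
    have h₂ : (3 * n + 30) * l ≤ (3 * (w.length + c.length) + 30) * (w.length + c.length) := by
      gcongr <;> omega
    have h₃ : (3 * (w.length + c.length) + 30) * (w.length + c.length) =
      3 * (w.length + c.length) * (w.length + c.length) + 30 * (w.length + c.length) := by ring
    omega
  have s₁ := runs_splitInput (fl := initFlags none) w c
  obtain ⟨n, l, hw, hl⟩ := exists_eq_replicate_append CNFSymbol.var w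
  have hlw : w.length = n + l.length := by simp [hw]
  have s₂ := runs_readVars (fl := { initFlags none with shape := c.head? }) (ce := none) (sy := none)
    (ib := none) (bi := none) (i := c.tail.map Sum.inr) (b := []) (q := []) (k := []) n l hl
  rw [← hw] at s₂
  have malformed : (∀ n (Ψ : DefiniteHornCNF (Fin n)), encodeCNF Ψ ≠ w) →
      (mal = true ↔ VerifierRel mal D w c) := by
    intro h
    refine ⟨fun e => .inl ⟨e, h⟩, ?_⟩
    rintro (⟨e, -⟩ | ⟨n, Ψ, C, e, -⟩)
    · exact e
    · exact absurd e (h n Ψ)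
  by_cases hsep : l.head? = some .sep
  · obtain ⟨l, rfl⟩ : ∃ l', l = .sep :: l' := by
      cases l <;> simp_all
    obtain ⟨v, S, s₃, ht, hf⟩ := runs_validateRows (fl := { initFlags none with shape := c.head? })
      (sy := none) (i := c.tail.map Sum.inr) (k := []) n rfl rfl l
    cases hr : rowsValid n n false l
    · refine ⟨_, _, (Runs.seq s₁ <| .seq s₂ <| .seq (.ite_true rfl <| .seq (.load _ _ _) s₃) <|
        .ite_true (hf hr) (.load _ _ _) : Runs (verifier mal Q) _ _ _ _ _).mono
        (time n l.length _ ?_ ?_), malformed ?_⟩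
      · simp [hw]
      · omega
      · intro m Ψ hΨ
        rw [hw, encodeCNF_eq] at hΨ
        obtain ⟨rfl, h⟩ := replicate_append_inj (by simp) (by simp) hΨ
        have := rowsValid_rowsOf Ψ
        rw [(List.cons.inj h).2, hr] at this
        simp at this
    · obtain ⟨rfl, rfl⟩ := ht hr
      obtain ⟨Ψ, rfl⟩ := (rowsValid_iff l).1 hr
      obtain ⟨v, S, s₄, hc, hn⟩ := runs_readCert (r := rowsOf Ψ) (q := []) (k := []) n c
      -- By unique decoding, the quantifier over CNFs reduces to the one that was read.
      have key : VerifierRel mal D w c ↔ ∃ C : Certificate (Fin n), C.encode = c ∧ D n Ψ C := by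
        rw [← encodeCNF_eq] at hw
        constructor
        · rintro (⟨-, h⟩ | ⟨m, Φ, C, h, h', h''⟩)
          · exact absurd hw.symm (h n Ψ)
          · obtain ⟨rfl, e⟩ := encodeCNF_injective (h.trans hw)
            rw [heq_iff_eq] at e
            subst e
            exact ⟨C, h', h''⟩
        · rintro ⟨C, h, h'⟩
          exact .inr ⟨n, Ψ, C, hw.symm, h, h'⟩
      by_cases hex : ∃ C : Certificate (Fin n), C.encode = c
      · obtain ⟨C, hC⟩ := hex
        obtain ⟨rfl, rfl⟩ := hc C hC
        obtain ⟨F, hF, hF'⟩ := hQ n Ψ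
        have hbad : (certData C).1.bad = false := by cases C <;> rfl
        refine ⟨_, _, (Runs.seq s₁ <| .seq s₂ <| .seq (.ite_true rfl <| .seq (.load _ _ _) s₃) <|
          .ite_false rfl <| .seq s₄ <| .ite_false hbad (hF (certData C) []) :
          Runs (verifier mal Q) _ _ _ _ _).mono (time n (rowsOf Ψ).length _ ?_ ?_), ?_⟩
        · simp [hw]
        · omega
        · simp only [hF', key]
          constructor
          · exact fun h => ⟨C, hC, h⟩
          · rintro ⟨C', hC', h⟩
            rwa [← certificate_encode_injective (hC'.trans hC.symm)]
      · push Not at hex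
        refine ⟨_, _, (Runs.seq s₁ <| .seq s₂ <| .seq (.ite_true rfl <| .seq (.load _ _ _) s₃) <|
          .ite_false rfl <| .seq s₄ <| .ite_true (hn hex) (.load _ _ _) :
          Runs (verifier mal Q) _ _ _ _ _).mono (time n (rowsOf Ψ).length _ ?_ ?_), ?_⟩
        · simp [hw]
        · omega
        · rw [key]
          simp only [Bool.false_eq_true, false_iff, not_exists, not_and]
          exact fun C hC => absurd hC (hex C)
  · refine ⟨_, _, (Runs.seq s₁ <| .seq s₂ <| .seq (.ite_false (by simpa using hsep) <|
      .load _ _ _) <| .ite_true rfl (.load _ _ _) : Runs (verifier mal Q) _ _ _ _ _).mono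
      (time n l.length _ ?_ ?_), malformed ?_⟩
    · omega
    · omega
    · intro m Ψ hΨ
      rw [hw, encodeCNF_eq] at hΨ
      obtain ⟨-, h⟩ := replicate_append_inj (by simp) hl hΨ
      rw [← h] at hsep
      simp at hsep

/-- Empties all stacks. -/
def drain : Prog :=
  .seq (.seq popInp <| .loop (fun v => v.inb.isSome) popInp) <|
  .seq (.seq popVec <| .loop (fun v => v.cell.isSome) popVec) <|
  .seq (.seq popBak <| .loop (fun v => v.cell.isSome) popBak) <|
  .seq (.seq popRows <| .loop (fun v => v.sym.isSome) popRows) <|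
  .seq (.seq popRowb <| .loop (fun v => v.sym.isSome) popRowb)
  (.seq popCnt <| .loop (fun v => v.bit.isSome) popCnt)

theorem runs_drain : Runs drain ⟨fl, ce, sy, ib, bi⟩ (memory i a b r q k)
    ⟨fl, none, none, none, none⟩ (memory [] [] [] [] [] [])
    (2 * (i.length + a.length + b.length + r.length + q.length + k.length) + 12) := by
  have h₁ : ∀ i : List (CNFSymbol ⊕ Bool), Runs (.loop (fun v => v.inb.isSome) popInp) ⟨fl, ce, sy, i.head?, bi⟩
      (memory i.tail a b r q k) ⟨fl, ce, sy, none, bi⟩ (memory [] a b r q k)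
      (2 * i.length + 1) := by
    intro i
    induction i with
    | nil => exact .loop_false rfl
    | cons y i ih => exact (Runs.loop_true rfl runs_pop_inp ih).mono (by simp; omega)
  have h₂ : ∀ a : List Cell, Runs (.loop (fun v => v.cell.isSome) popVec) ⟨fl, a.head?, sy, none, bi⟩
      (memory [] a.tail b r q k) ⟨fl, none, sy, none, bi⟩ (memory [] [] b r q k)
      (2 * a.length + 1) := by
    intro a
    induction a with
    | nil => exact .loop_false rfl
    | cons y a ih => exact (Runs.loop_true rfl runs_pop_vec ih).mono (by simp; omega)
  have h₃ : ∀ b : List Cell, Runs (.loop (fun v => v.cell.isSome) popBak) ⟨fl, b.head?, sy, none, bi⟩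
      (memory [] [] b.tail r q k) ⟨fl, none, sy, none, bi⟩ (memory [] [] [] r q k)
      (2 * b.length + 1) := by
    intro b
    induction b with
    | nil => exact .loop_false rfl
    | cons y b ih => exact (Runs.loop_true rfl runs_pop_bak ih).mono (by simp; omega)
  have h₄ : ∀ r : List CNFSymbol, Runs (.loop (fun v => v.sym.isSome) popRows) ⟨fl, none, r.head?, none, bi⟩
      (memory [] [] [] r.tail q k) ⟨fl, none, none, none, bi⟩ (memory [] [] [] [] q k)
      (2 * r.length + 1) := by
    intro r
    induction r with
    | nil => exact .loop_false rfl
    | cons y r ih => exact (Runs.loop_true rfl runs_pop_rows ih).mono (by simp; omega)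
  have h₅ : ∀ q : List CNFSymbol, Runs (.loop (fun v => v.sym.isSome) popRowb) ⟨fl, none, q.head?, none, bi⟩
      (memory [] [] [] [] q.tail k) ⟨fl, none, none, none, bi⟩ (memory [] [] [] [] [] k)
      (2 * q.length + 1) := by
    intro q
    induction q with
    | nil => exact .loop_false rfl
    | cons y q ih => exact (Runs.loop_true rfl runs_pop_rowb ih).mono (by simp; omega)
  have h₆ : ∀ k : List Bool, Runs (.loop (fun v => v.bit.isSome) popCnt) ⟨fl, none, none, none, k.head?⟩
      (memory [] [] [] [] [] k.tail) ⟨fl, none, none, none, none⟩ (memory [] [] [] [] [] [])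
      (2 * k.length + 1) := by
    intro k
    induction k with
    | nil => exact .loop_false rfl
    | cons y k ih => exact (Runs.loop_true rfl runs_pop_cnt ih).mono (by simp; omega)
  exact (Runs.seq (.seq runs_pop_inp (h₁ i)) <| .seq (.seq runs_pop_vec (h₂ a)) <|
    .seq (.seq runs_pop_bak (h₃ b)) <| .seq (.seq runs_pop_rows (h₄ r)) <|
    .seq (.seq runs_pop_rowb (h₅ q)) (.seq runs_pop_cnt (h₆ k)) :
    Runs drain _ _ _ _ _).mono (by omega)

/-- Leaves the answer as the only output. -/
def answer : Prog :=
  .seq drain <| .seq (.push .cnt fun v => v.fl.res) (.load fun v => { v with fl := initFlags none })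

/-- The output convention requires all other stacks to be empty at the end. Emptying them is
affordable because a run of `T` steps lengthens them by at most `T` in total. -/
theorem polyTimeRel_verifierRel (mal : Bool) (Q : Prog) (P : Polynomial ℕ)
    (D : ∀ n, DefiniteHornCNF (Fin n) → Certificate (Fin n) → Prop)
    (hQ : ∀ n (Ψ : DefiniteHornCNF (Fin n)), ∃ F, Sim Ψ Q F P ∧
      ∀ C, (F (certData C)).1.res = true ↔ D n Ψ C) : PolyTimeRel (VerifierRel mal D) := by
  classical
  let _ : Fintype Ctl := Fintype.ofFinite Ctl
  let _ : Fintype (WorkAlphabet .inp) := inferInstanceAs (Fintype (CNFSymbol ⊕ Bool))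
  refine ⟨fun z => decide (VerifierRel mal D z.1 z.2), by simp, ?_⟩
  refine StackProg.computableInPolyTime (Γ := WorkAlphabet) (.seq (verifier mal Q) answer)
    WorkStack.inp WorkStack.cnt ⟨initFlags none, none, none, none, none⟩ _ _ _
    -- With `T` for the verifier, emptying takes `2 * (X + T) + 12` steps by `Runs.size_le`, and the
    -- answer takes two more.
    (3 * (3 * .X * .X + 80 * .X + 100 + P) + 2 * .X + 14) ?_
  rintro ⟨w, c⟩
  obtain ⟨v, S, h, hv⟩ := runs_verifier mal Q P D hQ w c
  set T := (3 * .X * .X + 80 * .X + 100 + P).eval (w.length + c.length) with hT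
  have hS : S = memory (S .inp) (S .vec) (S .bak) (S .rows) (S .rowb) (S .cnt) := by
    funext s; cases s <;> rfl
  have size := h.size_le
  have sum : ∀ f : WorkStack → ℕ, ∑ s, f s = f .inp + f .vec + f .bak + f .rows + f .rowb + f .cnt := by
    intro f
    simp [Finset.univ, Fintype.elems, add_assoc]
  rw [sum, sum] at size
  simp only [memory, List.length_append, List.length_map, List.length_nil] at size
  rw [hS] at h
  have main := Runs.seq h (.seq runs_drain <| .seq (runs_push_cnt (f := fun v => v.fl.res))
    (.load (fun v : Ctl => { v with fl := initFlags none }) _ _))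
  have e₁ : Function.update (fun _ => []) WorkStack.inp (w.map Sum.inl ++ c.map Sum.inr) =
      memory (w.map Sum.inl ++ c.map Sum.inr) [] [] [] [] [] := by
    funext s; cases s <;> rfl
  have e₂ : (Function.update (fun _ => []) WorkStack.cnt [v.fl.res] :
      ∀ s, List (WorkAlphabet s)) = memory [] [] [] [] [] [v.fl.res] := by
    funext s; cases s <;> rfl
  have e₃ : Computability.encodeBool (decide (VerifierRel mal D w c)) = [v.fl.res] := by
    have : decide (VerifierRel mal D w c) = v.fl.res := by
      rw [Bool.eq_iff_iff, decide_eq_true_iff, hv]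
    rw [this]
    rfl
  have e₄ : ((Computability.encodingProd (Computability.encodingList CNFSymbol)
      (Computability.encodingList Bool)).encode (w, c)) = w.map Sum.inl ++ c.map Sum.inr := rfl
  simp only [e₃, e₄]
  rw [e₁, e₂]
  refine main.mono ?_
  simp only [List.length_append, List.length_map, Polynomial.eval_add, Polynomial.eval_mul,
    Polynomial.eval_X, Polynomial.eval_ofNat] at hT ⊢
  omega

end Prog

/-! ### Forward chaining and implicate sets -/

section Horn

variable {n : ℕ} (Ψ : DefiniteHornCNF (Fin n))

/-- One round of forward chaining. -/
def chain (X : Finset (Fin n)) : Finset (Fin n) :=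
  Ψ.foldl (fun X C => if C.body ⊆ X then insert C.head X else X) X

theorem eval_eq_true {T : Finset (Fin n)} :
    Ψ.eval T = true ↔ ∀ C ∈ Ψ, C.body ⊆ T → C.head ∈ T := by
  simp only [DefiniteHornCNF.eval, SatisfiesImp]
  exact decide_eq_true_iff

theorem subset_chain (X : Finset (Fin n)) : X ⊆ chain Ψ X := by
  unfold chain
  induction Ψ generalizing X with
  | nil => exact subset_rfl
  | cons C Ψ ih =>
    rw [List.foldl_cons]
    refine subset_trans ?_ (ih _)
    split_ifs
    · exact Finset.subset_insert _ _
    · exact subset_rfl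

theorem chain_subset {X T : Finset (Fin n)} (hT : Ψ.eval T = true) (h : X ⊆ T) :
    chain Ψ X ⊆ T := by
  rw [eval_eq_true] at hT
  unfold chain
  induction Ψ generalizing X with
  | nil => exact h
  | cons C Ψ ih =>
    rw [List.foldl_cons]
    refine ih (fun D hD => hT D (List.mem_cons_of_mem _ hD)) ?_
    split_ifs with hC
    · exact Finset.insert_subset (hT C (by simp) (hC.trans h)) h
    · exact h

/-- Sets only grow during the fold. If the final set is `X`, every intermediate set is `X`, so each
clause was tested on `X` itself. -/
theorem eval_of_chain_eq {X : Finset (Fin n)} (h : chain Ψ X = X) : Ψ.eval X = true := by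
  rw [eval_eq_true]
  have hh : chain Ψ X ⊆ X := h.subset
  clear h
  unfold chain at hh
  induction Ψ with
  | nil => simp
  | cons C Ψ ih =>
    rw [List.foldl_cons] at hh
    by_cases hC : C.body ⊆ X
    · rw [if_pos hC] at hh
      have hm : C.head ∈ X := hh (subset_chain Ψ _ (Finset.mem_insert_self _ _))
      rw [Finset.insert_eq_self.2 hm] at hh
      simpa [hm] using ih hh
    · rw [if_neg hC] at hh
      simpa [hC] using ih hh

theorem chain_eq_iff {X : Finset (Fin n)} : chain Ψ X = X ↔ Ψ.eval X = true :=
  ⟨eval_of_chain_eq Ψ, fun h => (chain_subset Ψ h subset_rfl).antisymm (subset_chain Ψ X)⟩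

/-- A round that does not reach a fixed point adds a variable, so `n` rounds suffice. Every true set
above `X` is closed under the rounds, which makes the result the least such set. -/
theorem iterate_chain (X : Finset (Fin n)) : X ⊆ (chain Ψ)^[n] X ∧
    Ψ.eval ((chain Ψ)^[n] X) = true ∧
    ∀ T, Ψ.eval T = true → X ⊆ T → (chain Ψ)^[n] X ⊆ T := by
  have key : ∀ m, X ⊆ (chain Ψ)^[m] X ∧
      (Ψ.eval ((chain Ψ)^[m] X) = true ∨ m ≤ ((chain Ψ)^[m] X).card) ∧
      ∀ T, Ψ.eval T = true → X ⊆ T → (chain Ψ)^[m] X ⊆ T := by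
    intro m
    induction m with
    | zero => exact ⟨subset_rfl, .inr (Nat.zero_le _), fun _ _ h => h⟩
    | succ m ih =>
      obtain ⟨h₁, h₂, h₃⟩ := ih
      rw [Function.iterate_succ_apply']
      refine ⟨h₁.trans (subset_chain Ψ _), ?_, fun T hT h => chain_subset Ψ hT (h₃ T hT h)⟩
      by_cases he : Ψ.eval ((chain Ψ)^[m] X) = true
      · left
        rwa [(chain_eq_iff Ψ).2 he]
      · right
        have hss : (chain Ψ)^[m] X ⊂ chain Ψ ((chain Ψ)^[m] X) :=
          (subset_chain Ψ _).ssubset_of_ne fun h => he (eval_of_chain_eq Ψ h.symm)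
        have := Finset.card_lt_card hss
        have := h₂.resolve_left he
        omega
  obtain ⟨h₁, h₂, h₃⟩ := key n
  refine ⟨h₁, ?_, h₃⟩
  rcases h₂ with h | h
  · exact h
  -- The set of all variables is true because every clause has a head.
  · have hu : (chain Ψ)^[n] X = Finset.univ := by
      rw [← Finset.card_eq_iff_eq_univ, Fintype.card_fin]
      exact le_antisymm (by simpa using Finset.card_le_univ ((chain Ψ)^[n] X)) h
    rw [hu, eval_eq_true]
    simp

/-- The iterate is the least true set containing `A`, so it is the only true set that needs to be
tested. -/
theorem isImplicate_iff {A : Finset (Fin n)} {v : Fin n} :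
    IsImplicate Ψ.eval A v ↔ v ∈ (chain Ψ)^[n] A := by
  obtain ⟨h₁, h₂, h₃⟩ := iterate_chain Ψ A
  exact ⟨fun h => h _ h₂ h₁, fun h T hT hA => h₃ T hT hA h⟩

end Horn

theorem IsImplicate.mono {V : Type*} {f : BoolFn V} {A B : Finset V} {v : V}
    (h : IsImplicate f A v) (hAB : A ⊆ B) : IsImplicate f B v :=
  fun T hT hB => h T hT (hAB.trans hB)

/-! ### Duality -/

section Duality

variable {V : Type*} [DecidableEq V] {f : BoolFn V}

/-- The implication with head `v` is violated exactly when `v` is the only element of `I` outside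
`T`. -/
theorem forall_satisfiesImp_iff {I T : Finset V} :
    (∀ v ∈ I, SatisfiesImp (I.erase v) v T) ↔ (I \ T).card ≠ 1 := by
  constructor
  · intro h hc
    obtain ⟨v, hv⟩ := Finset.card_eq_one.1 hc
    have hv' : v ∈ I \ T := by simp [hv]
    rw [Finset.mem_sdiff] at hv'
    refine hv'.2 (h v hv'.1 fun x hx => ?_)
    by_contra hxT
    rw [Finset.mem_erase] at hx
    have : x ∈ I \ T := Finset.mem_sdiff.2 ⟨hx.2, hxT⟩
    rw [hv, Finset.mem_singleton] at this
    exact hx.1 this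
  · intro h v hv hIT
    by_contra hvT
    refine h (Finset.card_eq_one.2 ⟨v, ?_⟩)
    ext x
    rw [Finset.mem_sdiff, Finset.mem_singleton]
    constructor
    · rintro ⟨hx, hxT⟩
      by_contra hne
      exact hxT (hIT (Finset.mem_erase.2 ⟨hne, hx⟩))
    · rintro rfl
      exact ⟨hv, hvT⟩

/-- A set is an implicate set if and only if it never meets the complement of a true set in exactly
one element. -/
theorem isImplicateSet_iff {I : Finset V} :
    IsImplicateSet f I ↔ ∀ T, f T = true → (I \ T).card ≠ 1 := by
  simp only [← forall_satisfiesImp_iff, IsImplicateSet, IsImplicate]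
  exact ⟨fun h T hT v hv => h v hv T hT, fun h v hv T hT => h T hT v hv⟩

theorem circularFn_eq_true {H : Finset (Finset V)} {T : Finset V} :
    circularFn H T = true ↔ ∀ E ∈ H, (E \ T).card ≠ 1 := by
  simp only [circularFn, decide_eq_true_eq, forall_satisfiesImp_iff]

variable [Fintype V] (h : BoolFn V)

theorem iDual_eq_true {T : Finset V} : iDual h T = true ↔ IsImplicateSet h Tᶜ := by
  simp [iDual]

/-- The complements of the true sets of the dual are the implicate sets of `h`, so the orthogonality
criterion applies to them. -/
theorem isImplicateSet_iDual {I : Finset V} :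
    IsImplicateSet (iDual h) I ↔ ∀ J, IsImplicateSet h J → (I ∩ J).card ≠ 1 := by
  rw [isImplicateSet_iff]
  constructor
  · intro hI J hJ
    have := hI Jᶜ (by rwa [iDual_eq_true, compl_compl])
    rwa [Finset.sdiff_eq_inter_compl, compl_compl] at this
  · intro hI T hT
    rw [Finset.sdiff_eq_inter_compl]
    exact hI _ ((iDual_eq_true h).1 hT)

/-- The hypergraph consists of all implicate sets. By self-duality, `T` is true iff its complement
is an implicate set of the dual, that is, orthogonal to every edge. -/
theorem isHypergraphHorn_of_eq_iDual (hh : h = iDual h) : IsHypergraphHorn h := by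
  refine ⟨Finset.univ.filter (IsImplicateSet h), ?_⟩
  funext T
  have e : h T = true ↔ IsImplicateSet (iDual h) Tᶜ := by
    rw [← hh, ← iDual_eq_true, ← hh]
  rw [Bool.eq_iff_iff, circularFn_eq_true, e, isImplicateSet_iDual]
  simp only [Finset.mem_filter, Finset.mem_univ, true_and, Finset.sdiff_eq_inter_compl,
    Finset.inter_comm]

/-- Under self-duality the implicate sets are exactly the sets orthogonal to all implicate sets. A
pair violates one inclusion, a single set the other. -/
theorem ne_iDual_of_certifies {C : Certificate V} (hC : C.Certifies h) : h ≠ iDual h := by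
  intro hh
  cases C with
  | pair I J =>
    obtain ⟨hI, hJ, hIJ⟩ := hC
    rw [hh] at hI
    exact (isImplicateSet_iDual h).1 hI J hJ hIJ
  | single S =>
    refine hC.1 ?_
    rw [hh, isImplicateSet_iDual]
    exact hC.2

/-- The absence of certificates yields `ℐ = ℐ^⊥`. The hypergraph serves to return to true sets: its
edges are implicate sets, so a set whose complement is orthogonal to `ℐ` is true. -/
theorem eq_iDual_of_isHypergraphHorn (hh : IsHypergraphHorn h)
    (hC : ∀ C : Certificate V, ¬ C.Certifies h) : h = iDual h := by
  obtain ⟨H, rfl⟩ := hh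
  have key : ∀ I, IsImplicateSet (circularFn H) I ↔ IsImplicateSet (iDual (circularFn H)) I := by
    intro I
    rw [isImplicateSet_iDual]
    constructor
    · exact fun hI J hJ hc => hC (.pair I J) ⟨hI, hJ, hc⟩
    · intro hI
      by_contra hn
      exact hC (.single I) ⟨hn, hI⟩
  funext T
  rw [Bool.eq_iff_iff, iDual_eq_true, key, isImplicateSet_iDual]
  constructor
  · intro hT J hJ
    rw [Finset.inter_comm, ← Finset.sdiff_eq_inter_compl]
    exact isImplicateSet_iff.1 hJ T hT
  · intro hT
    rw [circularFn_eq_true]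
    intro E hE
    rw [Finset.sdiff_eq_inter_compl, Finset.inter_comm]
    exact hT E (isImplicateSet_iff.2 fun T' hT' => circularFn_eq_true.1 hT' E hE)

theorem ne_iDual_iff :
    h ≠ iDual h ↔ ¬ IsHypergraphHorn h ∨ ∃ C : Certificate V, C.Certifies h := by
  constructor
  · intro hh
    by_contra hn
    push Not at hn
    exact hh (eq_iDual_of_isHypergraphHorn h hn.1 hn.2)
  · rintro (hh | ⟨C, hC⟩)
    · exact fun e => hh (isHypergraphHorn_of_eq_iDual h e)
    · exact ne_iDual_of_certifies h hC

end Duality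

namespace Prog

open StackProg

/-! ### The programs of the verifier -/

/-- The program `p` computes `F` in polynomial time. -/
def SimPoly (p : Prog) (F : ∀ n, DefiniteHornCNF (Fin n) → Data n → Data n) : Prop :=
  ∃ P, ∀ n (Ψ : DefiniteHornCNF (Fin n)), Sim Ψ p (F n Ψ) P

variable {p p₁ p₂ : Prog} {F F₁ F₂ : ∀ n, DefiniteHornCNF (Fin n) → Data n → Data n}

theorem SimPoly.seq (h₁ : SimPoly p₁ F₁) (h₂ : SimPoly p₂ F₂) :
    SimPoly (.seq p₁ p₂) (fun n Ψ d => F₂ n Ψ (F₁ n Ψ d)) :=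
  ⟨_, fun n Ψ => (h₁.choose_spec n Ψ).seq (h₂.choose_spec n Ψ)⟩

theorem SimPoly.ite (t : Flags → Bool) (h₁ : SimPoly p₁ F₁) (h₂ : SimPoly p₂ F₂) :
    SimPoly (.ite (fun v => t v.fl) p₁ p₂)
      (fun n Ψ d => if t d.1 then F₁ n Ψ d else F₂ n Ψ d) :=
  ⟨_, fun n Ψ => (h₁.choose_spec n Ψ).ite t (h₂.choose_spec n Ψ)⟩

theorem SimPoly.repeatAll (h : SimPoly p F) :
    SimPoly (repeatAll p) (fun n Ψ => (F n Ψ)^[n]) :=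
  ⟨_, fun n Ψ => (h.choose_spec n Ψ).repeatAll⟩

/-- The data in which the marks of the variables are given by sets. -/
def markData {n : ℕ} (fl : Flags) (A B W X C D : Finset (Fin n)) : Data n :=
  -- The mark `h` is `false` throughout: it is used only within a row and cleared at the separator.
  (fl, fun j => ⟨decide (j ∈ A), decide (j ∈ B), decide (j ∈ W), decide (j ∈ X), false,
    decide (j ∈ C), decide (j ∈ D)⟩)

def setFlagsF (f : Flags → Flags) (n : ℕ) (_ : DefiniteHornCNF (Fin n)) (d : Data n) : Data n :=
  (f d.1, d.2)

theorem simPoly_setFlags (f : Flags → Flags) : SimPoly (setFlags f) (setFlagsF f) :=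
  ⟨_, fun _ _ => sim_setFlags f⟩

def mapCellsF (u : Cell → Cell) (n : ℕ) (_ : DefiniteHornCNF (Fin n)) (d : Data n) : Data n :=
  (d.1, fun j => u (d.2 j))

theorem simPoly_mapCells (u : Cell → Cell) : SimPoly (mapCells fun _ => u) (mapCellsF u) :=
  ⟨_, fun _ _ => sim_mapCells fun _ => u⟩

/-- Tests whether all cells satisfy `t`. -/
def testAll (t : Cell → Bool) : Prog :=
  .seq (setFlags fun fl => { fl with one := true })
    (foldCells fun fl y => { fl with one := fl.one && t y })

def testAllF (t : Cell → Bool) (n : ℕ) (_ : DefiniteHornCNF (Fin n)) (d : Data n) : Data n :=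
  ({ d.1 with one := decide (∀ j, t (d.2 j) = true) }, d.2)

theorem simPoly_testAll (t : Cell → Bool) : SimPoly (testAll t) (testAllF t) := by
  refine ⟨1 + (7 * .X + 4), fun n Ψ => ?_⟩
  have h := (sim_setFlags (Ψ := Ψ) fun fl => { fl with one := true }).seq
    (sim_foldCells fun fl y => { fl with one := fl.one && t y })
  have key : ∀ (l : List Cell) (fl : Flags),
      l.foldl (fun fl y => ({ fl with one := fl.one && t y } : Flags)) fl =
      { fl with one := fl.one && l.all t } := by
    intro l
    induction l with
    | nil => intro fl; simp
    | cons y l ih => intro fl; simp [ih, Bool.and_assoc]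
  refine (congrArg (fun F => Sim Ψ (testAll t) F _) ?_).mpr h
  funext d
  rw [key]
  simp only [testAllF, Bool.true_and]
  congr 2
  rw [Bool.eq_iff_iff, decide_eq_true_iff, List.all_eq_true]
  simp [List.mem_ofFn]

/-- Counts the cells that satisfy `t`, up to two. -/
def countUpToTwo (t : Cell → Bool) : Prog :=
  .seq (setFlags fun fl => { fl with one := false, two := false })
    (foldCells fun fl y => { fl with one := fl.one || t y, two := fl.two || (fl.one && t y) })

def countUpToTwoF (t : Cell → Bool) (n : ℕ) (_ : DefiniteHornCNF (Fin n)) (d : Data n) : Data n :=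
  let c := (Finset.univ.filter fun j => t (d.2 j) = true).card
  ({ d.1 with one := decide (1 ≤ c), two := decide (2 ≤ c) }, d.2)

theorem simPoly_countUpToTwo (t : Cell → Bool) :
    SimPoly (countUpToTwo t) (countUpToTwoF t) := by
  refine ⟨1 + (7 * .X + 4), fun n Ψ => ?_⟩
  have h := (sim_setFlags (Ψ := Ψ) fun fl => { fl with one := false, two := false }).seq
    (sim_foldCells fun fl y => { fl with one := fl.one || t y, two := fl.two || (fl.one && t y) })
  have key : ∀ (l : List Cell) (fl : Flags),
      l.foldl (fun fl y => ({ fl with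
        one := fl.one || t y, two := fl.two || (fl.one && t y) } : Flags)) fl =
      { fl with
        one := fl.one || decide (1 ≤ (l.map t).count true)
        two := fl.two || (fl.one && decide (1 ≤ (l.map t).count true)) ||
          decide (2 ≤ (l.map t).count true) } := by
    intro l
    induction l with
    | nil => intro fl; simp
    | cons y l ih =>
      intro fl
      rw [List.foldl_cons, ih]
      cases hy : t y
      · simp [hy]
      · simp only [List.map_cons, hy, List.count_cons_self, Bool.or_true, Bool.and_true,
          Bool.true_and]
        generalize (l.map t).count true = m
        congr 1 <;> cases fl.one <;> cases fl.two <;> simp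
        omega
  refine (congrArg (fun F => Sim Ψ (countUpToTwo t) F _) ?_).mpr h
  funext d
  rw [key, List.map_ofFn, count_ofFn]
  simp [countUpToTwoF]

/-! ### Loops with a mark on the current variable. -/

/-- Marks the variable after the one marked by `c`. -/
def shiftC : Prog :=
  .seq (shiftMark Cell.c fun x y => { y with c := x }) (setFlags fun fl => { fl with carry := false })

/-- Marks the variable after the one marked by `d`. -/
def shiftD : Prog :=
  .seq (shiftMark Cell.d fun x y => { y with d := x }) (setFlags fun fl => { fl with carry := false })

def shiftF (get : Cell → Bool) (set : Bool → Cell → Cell) (n : ℕ) (_ : DefiniteHornCNF (Fin n))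
    (d : Data n) : Data n :=
  ({ d.1 with carry := false }, fun j => set (prevMark get d j) (d.2 j))

theorem simPoly_shiftC : SimPoly shiftC (shiftF Cell.c fun x y => { y with c := x }) :=
  ⟨_, fun _ _ => sim_shiftMark _ _⟩

theorem simPoly_shiftD : SimPoly shiftD (shiftF Cell.d fun x y => { y with d := x }) :=
  ⟨_, fun _ _ => sim_shiftMark _ _⟩

/-- The variable treated before the `i`-th iteration of a loop. -/
def preceding (n i : ℕ) : Finset (Fin n) := Finset.univ.filter fun j => j.val + 1 = i

theorem preceding_zero (n : ℕ) : preceding n 0 = ∅ := by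
  simp [preceding]

theorem preceding_succ {n i : ℕ} (hi : i < n) : preceding n (i + 1) = {⟨i, hi⟩} := by
  ext j
  simp [preceding, Fin.ext_iff]

variable {n : ℕ} (Ψ : DefiniteHornCNF (Fin n)) {fl : Flags} {A B W X C D : Finset (Fin n)}

/-- Before the first iteration no variable is marked and `carry` is set, so the shift marks variable
`0`; later `carry` is clear and the mark moves on by one. -/
theorem shiftC_markData (i : ℕ) :
    shiftF Cell.c (fun x y => { y with c := x }) n Ψ
      (markData { fl with carry := decide (i = 0) } A B W X (preceding n i) D) =
    markData { fl with carry := false } A B W X (preceding n (i + 1)) D := by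
  simp only [shiftF, markData, prevMark, preceding, Finset.mem_filter, Finset.mem_univ, true_and]
  congr 1
  funext j
  congr 1
  split_ifs with hj
  · simp [hj]
  · congr 1
    rw [eq_iff_iff]
    omega

theorem shiftD_markData (i : ℕ) :
    shiftF Cell.d (fun x y => { y with d := x }) n Ψ
      (markData { fl with carry := decide (i = 0) } A B W X C (preceding n i)) =
    markData { fl with carry := false } A B W X C (preceding n (i + 1)) := by
  simp only [shiftF, markData, prevMark, preceding, Finset.mem_filter, Finset.mem_univ, true_and]
  congr 1
  funext j
  congr 1
  split_ifs with hj
  · simp [hj]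
  · congr 1
    rw [eq_iff_iff]
    omega

def chainRoundF (n : ℕ) (Ψ : DefiniteHornCNF (Fin n)) (d : Data n) : Data n :=
  ({ d.1 with ok := true }, Ψ.foldl clauseStep d.2)

theorem simPoly_chainRound : SimPoly chainRound chainRoundF := ⟨_, fun _ Ψ => sim_chainRound Ψ⟩

theorem chainRound_markData (hfl : fl.ok = true) :
    chainRoundF n Ψ (markData fl A B W X C D) = markData fl A B W (chain Ψ X) C D := by
  have key : ∀ X, Ψ.foldl clauseStep (markData fl A B W X C D).2 =
      (markData fl A B W (chain Ψ X) C D).2 := by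
    unfold chain
    induction Ψ with
    | nil => intro X; rfl
    | cons E Ψ ih =>
      intro X
      rw [List.foldl_cons, List.foldl_cons, ← ih]
      congr 1
      funext j
      simp only [clauseStep, markData, decide_eq_true_eq, ← Finset.subset_iff]
      congr 1
      rw [Bool.eq_iff_iff]
      split_ifs with hE
      · simp [hE, or_comm]
      · simp [hE]
  refine Prod.ext ?_ (key X)
  simp [chainRoundF, markData, ← hfl]

/-- Forward chaining from the set marked by `x`. -/
def chase : Prog := repeatAll chainRound

def chaseF (n : ℕ) (Ψ : DefiniteHornCNF (Fin n)) : Data n → Data n := (chainRoundF n Ψ)^[n]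

theorem simPoly_chase : SimPoly chase chaseF := simPoly_chainRound.repeatAll

theorem chase_markData (hfl : fl.ok = true) :
    chaseF n Ψ (markData fl A B W X C D) = markData fl A B W ((chain Ψ)^[n] X) C D := by
  have key : ∀ m, (chainRoundF n Ψ)^[m] (markData fl A B W X C D) =
      markData fl A B W ((chain Ψ)^[m] X) C D := by
    intro m
    induction m with
    | zero => rfl
    | succ m ih =>
      rw [Function.iterate_succ_apply', ih, chainRound_markData Ψ hfl, Function.iterate_succ_apply']
  exact key n

/-! ### The largest implicate subset. -/

/-- Removes the next variable from the set marked by `w` unless it is implied by the others. -/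
def prune : Prog :=
  .seq shiftC <| .seq (mapCells fun _ y => { y with x := y.w && !y.c }) <|
  .seq chase (mapCells fun _ y => { y with w := y.w && (!y.c || y.x) })

def pruneF (n : ℕ) (Ψ : DefiniteHornCNF (Fin n)) (d : Data n) : Data n :=
  mapCellsF (fun y => { y with w := y.w && (!y.c || y.x) }) n Ψ <| chaseF n Ψ <|
  mapCellsF (fun y => { y with x := y.w && !y.c }) n Ψ <|
  shiftF Cell.c (fun x y => { y with c := x }) n Ψ d

theorem simPoly_prune : SimPoly prune pruneF :=
  simPoly_shiftC.seq <| (simPoly_mapCells _).seq <| simPoly_chase.seq <| simPoly_mapCells _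

theorem prune_markData (hfl : fl.ok = true) {i : ℕ} (hi : i < n) :
    ∃ X', pruneF n Ψ (markData { fl with carry := decide (i = 0) } A B W X (preceding n i) D) =
      markData { fl with carry := false } A B
        (W.filter fun j => j ≠ ⟨i, hi⟩ ∨ j ∈ (chain Ψ)^[n] (W.erase ⟨i, hi⟩)) X'
        (preceding n (i + 1)) D := by
  have e : mapCellsF (fun y => { y with x := y.w && !y.c }) n Ψ
      (markData { fl with carry := false } A B W X (preceding n (i + 1)) D) =
      markData { fl with carry := false } A B W (W.erase ⟨i, hi⟩) (preceding n (i + 1)) D := by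
    refine Prod.ext rfl (funext fun j => ?_)
    simp [mapCellsF, markData, preceding_succ hi, Bool.and_comm]
  refine ⟨(chain Ψ)^[n] (W.erase ⟨i, hi⟩), ?_⟩
  rw [pruneF, shiftC_markData, e, chase_markData Ψ (fl := { fl with carry := false }) hfl]
  refine Prod.ext rfl (funext fun j => ?_)
  simp only [mapCellsF, markData, preceding_succ hi, Finset.mem_filter, Finset.mem_singleton]
  congr 1
  rw [Bool.eq_iff_iff]
  by_cases hj : j = ⟨i, hi⟩
  · simp [hj]
  · simp [hj]

/-- Executes `prune` for all variables. -/
def sweep : Prog :=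
  .seq (setFlags fun fl => { fl with carry := true }) <| .seq (repeatAll prune) <|
  .seq (setFlags fun fl => { fl with carry := false }) (mapCells fun _ y => { y with c := false })

def sweepF (n : ℕ) (Ψ : DefiniteHornCNF (Fin n)) (d : Data n) : Data n :=
  mapCellsF (fun y => { y with c := false }) n Ψ <|
  setFlagsF (fun fl => { fl with carry := false }) n Ψ <| (pruneF n Ψ)^[n] <|
  setFlagsF (fun fl => { fl with carry := true }) n Ψ d

theorem simPoly_sweep : SimPoly sweep sweepF :=
  (simPoly_setFlags _).seq <| simPoly_prune.repeatAll.seq <|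
  (simPoly_setFlags _).seq <| simPoly_mapCells _

/-- If `I ⊆ W` is an implicate set, each `j ∈ I` is implied by `I - j`, hence by `W - j`, and
survives. One sweep need not end at an implicate set, because later removals may spoil earlier
tests; if nothing is removed, all tests refer to the same set. -/
theorem sweep_markData (hok : fl.ok = true) (hc : fl.carry = false) :
    ∃ W' X', sweepF n Ψ (markData fl A B W X ∅ D) = markData fl A B W' X' ∅ D ∧ W' ⊆ W ∧
      (∀ I, IsImplicateSet Ψ.eval I → I ⊆ W → I ⊆ W') ∧
      (W' = W → IsImplicateSet Ψ.eval W) := by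
  have key : ∀ i ≤ n, ∃ W' X', (pruneF n Ψ)^[i]
      (markData { fl with carry := true } A B W X (preceding n 0) D) =
      markData { fl with carry := decide (i = 0) } A B W' X' (preceding n i) D ∧ W' ⊆ W ∧
      (∀ I, IsImplicateSet Ψ.eval I → I ⊆ W → I ⊆ W') ∧
      (W' = W → ∀ j ∈ W, j.val < i → IsImplicate Ψ.eval (W.erase j) j) := by
    intro i
    induction i with
    | zero => exact fun _ => ⟨W, X, rfl, subset_rfl, fun _ _ h => h, by simp⟩
    | succ i ih =>
      intro hi
      obtain ⟨W', X', h₁, h₂, h₃, h₄⟩ := ih (by omega)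
      obtain ⟨X'', h⟩ := prune_markData Ψ (fl := fl) (A := A) (B := B) (W := W') (X := X') (D := D)
        hok (i := i) (by omega)
      refine ⟨_, X'', by rw [Function.iterate_succ_apply', h₁, h]; rfl,
        (Finset.filter_subset _ _).trans h₂, ?_, ?_⟩
      · intro I hI hIW j hj
        refine Finset.mem_filter.2 ⟨h₃ I hI hIW hj, ?_⟩
        by_cases hji : j = ⟨i, hi⟩
        · right
          subst hji
          rw [← isImplicate_iff]
          exact (hI _ hj).mono (Finset.erase_subset_erase _ (h₃ I hI hIW))
        · exact .inl hji
      · intro hW j hj hji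
        -- If nothing is missing after this step, nothing was removed before it.
        have hW' : W' = W := h₂.antisymm (by rw [← hW]; exact Finset.filter_subset _ _)
        subst hW'
        by_cases hj' : j.val = i
        · have := hW ▸ hj
          rw [Finset.mem_filter] at this
          rw [isImplicate_iff]
          obtain rfl : j = ⟨i, hi⟩ := Fin.ext hj'
          exact this.2.resolve_left (by simp)
        · exact h₄ rfl j hj (by omega)
  obtain ⟨W', X', h₁, h₂, h₃, h₄⟩ := key n le_rfl
  refine ⟨W', X', ?_, h₂, h₃, fun h j hj => h₄ h j hj j.2⟩
  have e : setFlagsF (fun fl => { fl with carry := true }) n Ψ (markData fl A B W X ∅ D) =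
      markData { fl with carry := true } A B W X (preceding n 0) D := by
    rw [preceding_zero]; rfl
  rw [sweepF, e, h₁]
  refine Prod.ext ?_ (funext fun j => ?_)
  · simp [mapCellsF, setFlagsF, markData, ← hc]
  · simp [mapCellsF, setFlagsF, markData]

/-- Reduces the set marked by `w` to its largest implicate subset. -/
def core : Prog := repeatAll sweep

def coreF (n : ℕ) (Ψ : DefiniteHornCNF (Fin n)) : Data n → Data n := (sweepF n Ψ)^[n]

theorem simPoly_core : SimPoly core coreF := simPoly_sweep.repeatAll

/-- A sweep from a set that is not an implicate set removes a variable. After `n` sweeps the set is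
therefore an implicate set or empty, and the empty set is an implicate set too. -/
theorem core_markData (hok : fl.ok = true) (hc : fl.carry = false) :
    ∃ W' X', coreF n Ψ (markData fl A B W X ∅ D) = markData fl A B W' X' ∅ D ∧ W' ⊆ W ∧
      (∀ I, IsImplicateSet Ψ.eval I → I ⊆ W → I ⊆ W') ∧ IsImplicateSet Ψ.eval W' := by
  have key : ∀ m, ∃ W' X', (sweepF n Ψ)^[m] (markData fl A B W X ∅ D) =
      markData fl A B W' X' ∅ D ∧ W' ⊆ W ∧
      (∀ I, IsImplicateSet Ψ.eval I → I ⊆ W → I ⊆ W') ∧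
      (IsImplicateSet Ψ.eval W' ∨ W'.card + m ≤ W.card) := by
    intro m
    induction m with
    | zero => exact ⟨W, X, rfl, subset_rfl, fun _ _ h => h, .inr le_rfl⟩
    | succ m ih =>
      obtain ⟨W', X', h₁, h₂, h₃, h₄⟩ := ih
      obtain ⟨W'', X'', g₁, g₂, g₃, g₄⟩ := sweep_markData Ψ (fl := fl) (A := A) (B := B) (W := W')
        (X := X') (D := D) hok hc
      refine ⟨W'', X'', by rw [Function.iterate_succ_apply', h₁, g₁], g₂.trans h₂,
        fun I hI hIW => g₃ I hI (h₃ I hI hIW), ?_⟩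
      by_cases hW : W'' = W'
      · left
        rw [hW]
        exact g₄ hW
      · by_cases hI : IsImplicateSet Ψ.eval W'
        · exact absurd (g₂.antisymm (g₃ W' hI subset_rfl)) hW
        · right
          have := h₄.resolve_left hI
          have := Finset.card_lt_card (g₂.ssubset_of_ne hW)
          omega
  obtain ⟨W', X', h₁, h₂, h₃, h₄⟩ := key n
  refine ⟨W', X', h₁, h₂, h₃, h₄.elim id fun h => ?_⟩
  have : W.card ≤ n := by simpa using Finset.card_le_univ W
  rw [Finset.card_eq_zero.1 (by omega : W'.card = 0)]
  simp [IsImplicateSet]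

/-- Tests whether the set of the variables whose marks satisfy `t` is an implicate set. -/
def testImplicateSet (t : Cell → Bool) : Prog :=
  .seq (mapCells fun _ y => { y with w := t y }) <| .seq core <| testAll fun y => y.w == t y

def testImplicateSetF (t : Cell → Bool) (n : ℕ) (Ψ : DefiniteHornCNF (Fin n)) (d : Data n) :
    Data n :=
  testAllF (fun y => y.w == t y) n Ψ <| coreF n Ψ <| mapCellsF (fun y => { y with w := t y }) n Ψ d

theorem simPoly_testImplicateSet (t : Cell → Bool) :
    SimPoly (testImplicateSet t) (testImplicateSetF t) :=
  (simPoly_mapCells _).seq <| simPoly_core.seq <| simPoly_testAll _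

/-- A set is an implicate set iff it equals its largest implicate subset. The test `t` must not
depend on `W` and `X`, which the computation overwrites. -/
theorem testImplicateSet_markData (t : Cell → Bool) (T : Finset (Fin n))
    (ht : ∀ W X j, t ((markData fl A B W X ∅ D).2 j) = decide (j ∈ T))
    (hok : fl.ok = true) (hc : fl.carry = false) :
    ∃ W' X', testImplicateSetF t n Ψ (markData fl A B W X ∅ D) =
      markData { fl with one := decide (IsImplicateSet Ψ.eval T) } A B W' X' ∅ D := by
  obtain ⟨W', X', h₁, h₂, h₃, h₄⟩ := core_markData Ψ (fl := fl) (A := A) (B := B) (W := T)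
    (X := X) (D := D) hok hc
  have e : mapCellsF (fun y => { y with w := t y }) n Ψ (markData fl A B W X ∅ D) =
      markData fl A B T X ∅ D := by
    refine Prod.ext rfl (funext fun j => ?_)
    simp only [mapCellsF, ht]
    rfl
  refine ⟨W', X', ?_⟩
  rw [testImplicateSetF, e, h₁]
  simp only [testAllF, ht]
  have e' : (∀ j, (((markData fl A B W' X' ∅ D).2 j).w == decide (j ∈ T)) = true) ↔
      IsImplicateSet Ψ.eval T := by
    simp only [markData, beq_iff_eq, decide_eq_decide, ← Finset.ext_iff]
    refine ⟨fun h => h ▸ h₄, fun h => h₂.antisymm (h₃ T h subset_rfl)⟩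
  simp only [e']
  rfl

end Prog

namespace Prog

open StackProg

variable {n : ℕ} (Ψ : DefiniteHornCNF (Fin n)) {fl : Flags} {A B W X C D : Finset (Fin n)}

theorem certData_pair (I J : Finset (Fin n)) :
    certData (.pair I J) = markData (initFlags (some true)) I J ∅ ∅ ∅ ∅ :=
  Prod.ext rfl (funext fun j => by
    simp [certData, certCell, markData,
      show (default : Cell) = ⟨false, false, false, false, false, false, false⟩ from rfl])

theorem certData_single (S : Finset (Fin n)) :
    certData (.single S) = markData (initFlags (some false)) S ∅ ∅ ∅ ∅ ∅ :=
  Prod.ext rfl (funext fun j => by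
    simp [certData, certCell, markData,
      show (default : Cell) = ⟨false, false, false, false, false, false, false⟩ from rfl])

/-! ### Pairs -/

/-- Decides whether the input sets certify as a pair. -/
def checkPair : Prog :=
  .seq (setFlags fun fl => { fl with ok := true }) <|
  .seq (testImplicateSet Cell.a) <|
  .seq (setFlags fun fl => { fl with res := fl.one }) <|
  .seq (testImplicateSet Cell.b) <|
  .seq (setFlags fun fl => { fl with res := fl.res && fl.one }) <|
  .seq (countUpToTwo fun y => y.a && y.b)
  (setFlags fun fl => { fl with res := fl.res && (fl.one && !fl.two) })

def checkPairF (n : ℕ) (Ψ : DefiniteHornCNF (Fin n)) (d : Data n) : Data n :=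
  setFlagsF (fun fl => { fl with res := fl.res && (fl.one && !fl.two) }) n Ψ <|
  countUpToTwoF (fun y => y.a && y.b) n Ψ <|
  setFlagsF (fun fl => { fl with res := fl.res && fl.one }) n Ψ <|
  testImplicateSetF Cell.b n Ψ <|
  setFlagsF (fun fl => { fl with res := fl.one }) n Ψ <|
  testImplicateSetF Cell.a n Ψ <|
  setFlagsF (fun fl => { fl with ok := true }) n Ψ d

theorem simPoly_checkPair : SimPoly checkPair checkPairF :=
  (simPoly_setFlags _).seq <| (simPoly_testImplicateSet _).seq <| (simPoly_setFlags _).seq <|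
  (simPoly_testImplicateSet _).seq <| (simPoly_setFlags _).seq <|
  (simPoly_countUpToTwo _).seq <| simPoly_setFlags _

theorem testAll_markData (t : Cell → Bool) (Q : Prop) [Decidable Q]
    (hQ : (∀ j, t ((markData fl A B W X C D).2 j) = true) ↔ Q) :
    testAllF t n Ψ (markData fl A B W X C D) = markData { fl with one := decide Q } A B W X C D :=
  Prod.ext (by simp only [testAllF, hQ]; rfl) rfl

theorem setFlags_markData (f : Flags → Flags) :
    setFlagsF f n Ψ (markData fl A B W X C D) = markData (f fl) A B W X C D := rfl

theorem checkPair_certData (I J : Finset (Fin n)) :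
    (checkPairF n Ψ (certData (.pair I J))).1.res = true ↔
      (Certificate.pair I J).Certifies Ψ.eval := by
  rw [certData_pair, checkPairF, setFlags_markData]
  obtain ⟨W₁, X₁, h₁⟩ := testImplicateSet_markData Ψ (fl := { initFlags (some true) with ok := true })
    (A := I) (B := J) (X := ∅) (W := ∅) (D := ∅) Cell.a I (fun _ _ _ => rfl) rfl rfl
  rw [h₁, setFlags_markData]
  obtain ⟨W₂, X₂, h₂⟩ := testImplicateSet_markData Ψ (fl := { initFlags (some true) with
    ok := true
    one := decide (IsImplicateSet Ψ.eval I)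
    res := decide (IsImplicateSet Ψ.eval I) })
    (A := I) (B := J) (X := X₁) (W := W₁) (D := ∅) Cell.b J (fun _ _ _ => rfl) rfl rfl
  erw [h₂]
  rw [setFlags_markData]
  have e : (Finset.univ.filter fun j => j ∈ I ∧ j ∈ J) = I ∩ J := by ext; simp
  simp only [countUpToTwoF, setFlagsF, markData, Bool.and_eq_true, decide_eq_true_eq, e,
    Certificate.Certifies, Bool.not_eq_true', decide_eq_false_iff_not, and_assoc]
  refine and_congr_right' (and_congr_right' ?_)
  omega

/-! ### Single sets -/

/-- Checks that no implicate set meets the set marked by `a` in the next variable only. -/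
def checkNext : Prog :=
  .seq shiftD <| .seq (mapCells fun _ y => { y with w := !y.a || y.d }) <| .seq core <|
  .seq (testAll fun y => !(y.a && y.d && y.w))
  (setFlags fun fl => { fl with res := fl.res && fl.one })

def checkNextF (n : ℕ) (Ψ : DefiniteHornCNF (Fin n)) (d : Data n) : Data n :=
  setFlagsF (fun fl => { fl with res := fl.res && fl.one }) n Ψ <|
  testAllF (fun y => !(y.a && y.d && y.w)) n Ψ <| coreF n Ψ <|
  mapCellsF (fun y => { y with w := !y.a || y.d }) n Ψ <|
  shiftF Cell.d (fun x y => { y with d := x }) n Ψ d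

theorem simPoly_checkNext : SimPoly checkNext checkNextF :=
  simPoly_shiftD.seq <| (simPoly_mapCells _).seq <| simPoly_core.seq <|
  (simPoly_testAll _).seq <| simPoly_setFlags _

/-- An implicate set `I` with `A ∩ I = {i}` lies in `Aᶜ ∪ {i}`, hence in the largest implicate
subset `W'` of that set. Conversely, if `i ∈ A` and `i ∈ W'`, then `W'` itself meets `A` in `i`
only. -/
theorem checkNext_markData (hok : fl.ok = true) {i : ℕ} (hi : i < n) :
    ∃ W' X' one, checkNextF n Ψ
      (markData { fl with carry := decide (i = 0) } A B W X ∅ (preceding n i)) =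
      markData { fl with
        carry := false
        one := one
        res := fl.res && decide (∀ I, IsImplicateSet Ψ.eval I → A ∩ I ≠ {⟨i, hi⟩}) } A B W' X' ∅
        (preceding n (i + 1)) := by
  obtain ⟨W', X', h₁, h₂, h₃, h₄⟩ := core_markData Ψ (fl := { fl with carry := false }) (A := A)
    (B := B) (W := Aᶜ ∪ {⟨i, hi⟩}) (X := X) (D := preceding n (i + 1)) hok rfl
  have e : mapCellsF (fun y => { y with w := !y.a || y.d }) n Ψ
      (markData { fl with carry := false } A B W X ∅ (preceding n (i + 1))) =
      markData { fl with carry := false } A B (Aᶜ ∪ {⟨i, hi⟩}) X ∅ (preceding n (i + 1)) := by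
    refine Prod.ext rfl (funext fun j => ?_)
    simp [mapCellsF, markData, preceding_succ hi, Bool.or_comm]
  have key : (∀ j, (!((decide (j ∈ A) && decide (j ∈ preceding n (i + 1))) && decide (j ∈ W'))) =
      true) ↔ ∀ I, IsImplicateSet Ψ.eval I → A ∩ I ≠ {⟨i, hi⟩} := by
    simp only [preceding_succ hi, Finset.mem_singleton, Bool.not_eq_true', Bool.and_eq_false_iff,
      decide_eq_false_iff_not]
    constructor
    · intro h I hI hAI
      have hm : (⟨i, hi⟩ : Fin n) ∈ A ∩ I := by simp [hAI]
      rw [Finset.mem_inter] at hm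
      have hI' : I ⊆ W' := h₃ I hI fun j hj => by
        by_cases hjA : j ∈ A
        · have : j ∈ A ∩ I := Finset.mem_inter.2 ⟨hjA, hj⟩
          rw [hAI] at this
          exact Finset.mem_union_right _ this
        · exact Finset.mem_union_left _ (Finset.mem_compl.2 hjA)
      have := h ⟨i, hi⟩
      simp [hm.1, hI' hm.2] at this
    · intro h j
      by_contra hn
      push Not at hn
      obtain ⟨⟨hjA, rfl⟩, hjW⟩ := hn
      refine h W' h₄ (Finset.Subset.antisymm (fun x hx => ?_) (by simp [hjA, hjW]))
      rw [Finset.mem_inter] at hx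
      simpa [hx.1] using h₂ hx.2
  refine ⟨W', X', decide (∀ I, IsImplicateSet Ψ.eval I → A ∩ I ≠ {⟨i, hi⟩}), ?_⟩
  rw [checkNextF, shiftD_markData, e, h₁, testAll_markData Ψ _ _ key]
  rfl

/-- Decides whether the first input set certifies as a single set. -/
def checkSingle : Prog :=
  .seq (setFlags fun fl => { fl with ok := true }) <| .seq (testImplicateSet Cell.a) <|
  .seq (setFlags fun fl => { fl with res := !fl.one, carry := true }) (repeatAll checkNext)

def checkSingleF (n : ℕ) (Ψ : DefiniteHornCNF (Fin n)) (d : Data n) : Data n :=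
  (checkNextF n Ψ)^[n] <|
  setFlagsF (fun fl => { fl with res := !fl.one, carry := true }) n Ψ <|
  testImplicateSetF Cell.a n Ψ <| setFlagsF (fun fl => { fl with ok := true }) n Ψ d

theorem simPoly_checkSingle : SimPoly checkSingle checkSingleF :=
  (simPoly_setFlags _).seq <| (simPoly_testImplicateSet _).seq <| (simPoly_setFlags _).seq <|
  simPoly_checkNext.repeatAll

theorem checkSingle_certData (S : Finset (Fin n)) :
    (checkSingleF n Ψ (certData (.single S))).1.res = true ↔
      (Certificate.single S).Certifies Ψ.eval := by
  obtain ⟨W₁, X₁, h₁⟩ := testImplicateSet_markData Ψ (fl := { initFlags (some false) with ok := true })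
    (A := S) (B := ∅) (X := ∅) (W := ∅) (D := ∅) Cell.a S (fun _ _ _ => rfl) rfl rfl
  set fl : Flags := { initFlags (some false) with
    ok := true
    res := !decide (IsImplicateSet Ψ.eval S) } with hfl
  have key : ∀ m ≤ n, ∃ W' X' one, (checkNextF n Ψ)^[m]
      (markData { fl with carry := true, one := decide (IsImplicateSet Ψ.eval S) } S ∅ W₁ X₁ ∅ ∅) =
      markData { fl with
        carry := decide (m = 0)
        one := one
        res := fl.res && decide (∀ s : Fin n, s.val < m → ∀ I, IsImplicateSet Ψ.eval I →
          S ∩ I ≠ {s}) } S ∅ W' X' ∅ (preceding n m) := by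
    intro m
    induction m with
    | zero =>
      intro _
      refine ⟨W₁, X₁, decide (IsImplicateSet Ψ.eval S), ?_⟩
      simp [preceding_zero]
    | succ m ih =>
      intro hm
      obtain ⟨W', X', one, h⟩ := ih (by omega)
      obtain ⟨W'', X'', one', h'⟩ := checkNext_markData Ψ (fl := { fl with
        one := one
        res := fl.res && decide (∀ s : Fin n, s.val < m → ∀ I, IsImplicateSet Ψ.eval I →
          S ∩ I ≠ {s}) }) (A := S) (B := ∅) (W := W') (X := X') rfl (i := m) (by omega)
      refine ⟨W'', X'', one', ?_⟩
      rw [Function.iterate_succ_apply', h]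
      refine h'.trans ?_
      congr 2
      rw [Bool.and_assoc]
      congr 1
      rw [Bool.eq_iff_iff]
      simp only [Bool.and_eq_true, decide_eq_true_eq]
      constructor
      · rintro ⟨g₁, g₂⟩ s hs
        by_cases hsm : s.val = m
        · obtain rfl : s = ⟨m, hm⟩ := Fin.ext hsm
          exact g₂
        · exact g₁ s (by omega)
      · exact fun g => ⟨fun s hs => g s (by omega), g ⟨m, hm⟩ (by simp)⟩
  obtain ⟨W', X', one, h⟩ := key n le_rfl
  rw [certData_single, checkSingleF, setFlags_markData, h₁, setFlags_markData]
  refine (iff_of_eq (congrArg (fun d : Data n => d.1.res = true) h)).trans ?_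
  simp only [markData, hfl, Bool.and_eq_true, Bool.not_eq_true', decide_eq_false_iff_not,
    decide_eq_true_eq, Certificate.Certifies, Finset.card_eq_one, not_exists, ne_eq]
  exact and_congr_right' ⟨fun g I hI s => g s s.2 I hI, fun g s _ I hI => g I hI s⟩

/-! ### Witnesses against self-duality -/

/-- Decides whether the function and its implicate-dual differ on the first input set. -/
def checkDual : Prog :=
  .seq (setFlags fun fl => { fl with ok := true }) <|
  .seq (mapCells fun _ y => { y with x := y.a }) <| .seq chainRound <|
  -- `testImplicateSet` overwrites `one`, so the first answer is saved in `two`.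
  .seq (testAll fun y => y.x == y.a) <| .seq (setFlags fun fl => { fl with two := fl.one }) <|
  .seq (testImplicateSet fun y => !y.a) (setFlags fun fl => { fl with res := fl.two != fl.one })

def checkDualF (n : ℕ) (Ψ : DefiniteHornCNF (Fin n)) (d : Data n) : Data n :=
  setFlagsF (fun fl => { fl with res := fl.two != fl.one }) n Ψ <|
  testImplicateSetF (fun y => !y.a) n Ψ <|
  setFlagsF (fun fl => { fl with two := fl.one }) n Ψ <|
  testAllF (fun y => y.x == y.a) n Ψ <| chainRoundF n Ψ <|
  mapCellsF (fun y => { y with x := y.a }) n Ψ <|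
  setFlagsF (fun fl => { fl with ok := true }) n Ψ d

theorem simPoly_checkDual : SimPoly checkDual checkDualF :=
  (simPoly_setFlags _).seq <| (simPoly_mapCells _).seq <| simPoly_chainRound.seq <|
  (simPoly_testAll _).seq <| (simPoly_setFlags _).seq <| (simPoly_testImplicateSet _).seq <|
  simPoly_setFlags _

/-- A set is true iff one round of forward chaining fixes it, and true for the dual iff its
complement is an implicate set. -/
theorem checkDual_certData (S : Finset (Fin n)) :
    (checkDualF n Ψ (certData (.single S))).1.res = true ↔ Ψ.eval S ≠ iDual Ψ.eval S := by
  have e : mapCellsF (fun y => { y with x := y.a }) n Ψ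
      (markData { initFlags (some false) with ok := true } S ∅ ∅ ∅ ∅ ∅) =
      markData { initFlags (some false) with ok := true } S ∅ ∅ S ∅ ∅ := rfl
  have e' : (∀ j, (decide (j ∈ chain Ψ S) == decide (j ∈ S)) = true) ↔ Ψ.eval S = true := by
    rw [← chain_eq_iff, Finset.ext_iff]
    simp
  obtain ⟨W₁, X₁, h₁⟩ := testImplicateSet_markData Ψ (fl := { initFlags (some false) with
    ok := true
    one := decide (Ψ.eval S = true)
    two := decide (Ψ.eval S = true) })
    (A := S) (B := ∅) (X := chain Ψ S) (W := ∅) (D := ∅) (fun y => !y.a) Sᶜ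
    (fun _ _ _ => by simp [markData]) rfl rfl
  rw [certData_single, checkDualF, setFlags_markData, e, chainRound_markData _ rfl,
    testAll_markData Ψ _ _ e', setFlags_markData]
  erw [h₁]
  simp [setFlagsF, markData, iDual]

end Prog

/-! ### Assembly of the three claims. -/

open Prog

/-- The condition that a set witnesses that a function differs from its implicate-dual. -/
def DualWitness (n : ℕ) (Ψ : DefiniteHornCNF (Fin n)) : Certificate (Fin n) → Prop
  | .pair _ _ => False
  | .single S => Ψ.eval S ≠ iDual Ψ.eval S

theorem polyTimeRel_certificateRel : PolyTimeRel CertificateRel := by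
  obtain ⟨P, hP⟩ := SimPoly.ite (fun fl => fl.shape == some true) simPoly_checkPair
    simPoly_checkSingle
  have h := polyTimeRel_verifierRel false _ P (fun _ Ψ C => C.Certifies Ψ.eval)
    fun n Ψ => ⟨_, hP n Ψ, fun C => ?_⟩
  · convert h using 1
    funext w c
    simp [VerifierRel, CertificateRel]
  · cases C with
    | pair I J => exact checkPair_certData Ψ I J
    | single S => exact checkSingle_certData Ψ S

theorem polyTimeRel_dualWitness : PolyTimeRel (VerifierRel true DualWitness) := by
  obtain ⟨P, hP⟩ := SimPoly.ite (fun fl => fl.shape == some true)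
    (simPoly_setFlags fun fl => { fl with res := false }) simPoly_checkDual
  refine polyTimeRel_verifierRel true _ P DualWitness fun n Ψ => ⟨_, hP n Ψ, fun C => ?_⟩
  cases C with
  | pair I J => exact iff_of_false Bool.false_ne_true id
  | single S => exact checkDual_certData Ψ S

theorem inCoNP_selfIDualProblem : InCoNP selfIDualProblem := by
  -- A witness has one shape bit and `n` bits for the set, and the word contains `n` symbols `var`.
  refine ⟨.X + 1, _, polyTimeRel_dualWitness, fun w => ?_⟩
  change w ∉ selfIDualProblem ↔ _
  constructor
  · intro hw
    by_cases h : ∃ (n : ℕ) (Ψ : DefiniteHornCNF (Fin n)), encodeCNF Ψ = w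
    · obtain ⟨n, Ψ, rfl⟩ := h
      have hne : Ψ.eval ≠ iDual Ψ.eval := fun e => hw ⟨n, Ψ, rfl, e⟩
      obtain ⟨S, hS⟩ := Function.ne_iff.1 hne
      refine ⟨(Certificate.single S).encode, ?_, .inr ⟨n, Ψ, .single S, rfl, rfl, hS⟩⟩
      simp [Certificate.encode, charVec, encodeCNF]
    -- A word that encodes no CNF lies in the complement of the language and is accepted with the
    -- empty certificate, hence `mal = true`.
    · push Not at h
      exact ⟨[], by simp, .inl ⟨rfl, h⟩⟩
  · rintro ⟨c, -, h | ⟨n, Ψ, C, rfl, rfl, hC⟩⟩ ⟨m, Φ, hΦ, e⟩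
    · exact h.2 m Φ hΦ
    · obtain ⟨rfl, h⟩ := encodeCNF_injective hΦ
      rw [heq_iff_eq] at h
      subst h
      cases C with
      | pair I J => exact hC
      | single S => exact hC (congrFun e S)

theorem mainTheorem11 :
    InCoNP selfIDualProblem ∧
    PolyTimeRel CertificateRel ∧
    (∀ (V : Type*) [Fintype V] [DecidableEq V] (h : BoolFn V), IsDefiniteHorn h →
      (h ≠ iDual h ↔ ¬ IsHypergraphHorn h ∨ ∃ C : Certificate V, C.Certifies h)) :=
  ⟨inCoNP_selfIDualProblem, polyTimeRel_certificateRel, fun _ _ _ h _ => ne_iDual_iff h⟩
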